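/- Let $p$ be a prime. Let $R$ be an F-finite Noetherian domain of characteristic $p$ (that is, $F_*R$ is a finite $R$-module; $F^e_*N$ denotes an $R$-module $N$ with $R$ acting through the $e$-th iterate of Frobenius). **Notation.** For a Noetherian ring $S$ of characteristic $p$, $S^\circ$ is the complement of the union of its minimal primes. For $S$-modules $L\subseteq M$, the tight closure $L^*_M$ consists of all $z\in M$ for which there are $c\in S^\circ$ and $e_0$ with $F^e_*c\otimes z\in\operatorname{im}(F^e_*S\otimes_S L\to F^e_*S\otimes_S M)$ for all $e\ge e_0$. The tight interior of an $S$-module $U$ is $$U_*=\bigcap_{c\in S^\circ}\bigcap_{e_0\ge 0}\sum_{e\ge e_0}\operatorname{im}\bigl(\operatorname{Hom}_S(F^e_*S,U)\to U,\ g\mapsto g(F^e_*c)\bigr).$$ An $S$-module $W$ is a durable test module if $\operatorname{im}(W\otimes_S L\to W\otimes_S M)=\operatorname{im}(W\otimes_S L^*_M\to W\otimes_S M)$ for all $S$-modules $L\subseteq M$. For a module $B$ over $R$, the module closure $\mathrm{cl}_B$ of $R$-modules $L\subseteq M$ is $$L^{\mathrm{cl}_B}_M=\{m\in M : m\otimes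 b\in\operatorname{im}(L\otimes_R B\to M\otimes_R B)\ \text{for all } b\in B\}.$$ A canonical module $\omega_S$ of a domain $S$ is an $S$-module isomorphic to $\operatorname{Ext}^c_A(S,A)$ for some presentation $S\cong A/P$ with $A$ a regular ring and $c$ the height of $P$; it is unique up to tensoring with an invertible $S$-module. Its parameter test submodule $\tau(\omega_S)$ is the smallest nonzero submodule $J\subseteq\omega_S$ with $\varphi(F^e_*J)\subseteq J$ for all $e\ge0$ and all $\varphi\in\operatorname{Hom}_S(F^e_*\omega_S,\omega_S)$. **Theorem.** For all $R$-modules $L\subseteq M$, $$L^*_M=\bigcap_S L^{\mathrm{cl}_{\tau(\omega_S)}}_M,$$ where the intersection is over all module-finite domain extensions $R\to S$ (and all canonical modules $\omega_S$ of $S$), with $\tau(\omega_S)$ regarded as an $R$-module. Moreover, for every module-finite domain extension $S$ of $R$, the tight interior $U_*$ of every $S$-module $U$ is a durable test module for $S$; $S$ has a canonical module; and $\tau(\omega_S)=(\omega_S)_*$ for every canonical module $\omega_S$ of $S$, so that $\tau(\omega_S)$ is a durable test module for $S$. -/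

import Mathlib

open scoped TensorProduct

universe u v w

/-- `FrobPush p e M` is the module usually written `F^e_* M`: the additive group of `M`, on which a
ring of characteristic `p` over which `M` is a module acts through the `e`-th iterate of
Frobenius, `r • F^e_* m = F^e_* (r ^ (p ^ e) • m)`. -/
def FrobPush (_p _e : ℕ) (M : Type u) : Type u := M

namespace FrobPush

instance instAddCommGroup (p e : ℕ) (M : Type*) [AddCommGroup M] :
    AddCommGroup (FrobPush p e M) :=
  inferInstanceAs (AddCommGroup M)

instance instModule (p e : ℕ) (M R : Type*) [AddCommGroup M] [CommRing R] [Fact p.Prime]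
    [CharP R p] [Module R M] : Module R (FrobPush p e M) :=
  Module.compHom M (iterateFrobenius R p e)

/-- `m ↦ F^e_* m`, the identity of the underlying additive groups. -/
def of (p e : ℕ) {M : Type*} [AddCommGroup M] : M ≃+ FrobPush p e M := AddEquiv.refl M

theorem smul_of (p e : ℕ) {M R : Type*} [AddCommGroup M] [CommRing R] [Fact p.Prime]
    [CharP R p] [Module R M] (r : R) (m : M) :
    r • of p e m = of p e (r ^ p ^ e • m) := rfl

/-- Multiplication by `F^e_* a` on `F^e_* R`, as an `R`-linear map. -/
def mulLeft (p e : ℕ) {R : Type*} [CommRing R] [Fact p.Prime] [CharP R p] (a : R) :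
    FrobPush p e R →ₗ[R] FrobPush p e R where
  toFun x := of p e (a * (of p e).symm x)
  map_add' x y := by simp [mul_add]
  map_smul' r x := by
    obtain ⟨y, rfl⟩ := (of p e).surjective x
    simp only [smul_of, AddEquiv.symm_apply_apply, smul_eq_mul, RingHom.id_apply]
    congr 1
    ring

end FrobPush

/-- A ring of characteristic `p` is F-finite if it is module-finite over itself along Frobenius. -/
def IsFFinite (p : ℕ) (R : Type*) [CommRing R] [Fact p.Prime] [CharP R p] : Prop :=
  (frobenius R p).Finite

/-- `R°`, the complement of the union of the minimal primes of `R`. -/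
def ringCirc (R : Type*) [CommRing R] : Set R := {c | ∀ P ∈ minimalPrimes R, c ∉ P}

theorem one_mem_ringCirc (R : Type*) [CommRing R] : (1 : R) ∈ ringCirc R := fun P hP h =>
  hP.isPrime.ne_top ((Ideal.eq_top_iff_one P).2 h)

theorem mul_mem_ringCirc {R : Type*} [CommRing R] {a b : R} (ha : a ∈ ringCirc R)
    (hb : b ∈ ringCirc R) : a * b ∈ ringCirc R := fun P hP h =>
  (hP.isPrime.mem_or_mem h).elim (ha P hP) (hb P hP)

section Closures

variable {R : Type*} [CommRing R] {M : Type*} [AddCommGroup M] [Module R M]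

/-- `L^{[p ^ e]}_M`, the image of `F^e_* R ⊗ L` in `F^e_* R ⊗ M`. -/
def frobeniusPower (p : ℕ) [Fact p.Prime] [CharP R p] (e : ℕ) (L : Submodule R M) :
    Submodule R (FrobPush p e R ⊗[R] M) :=
  LinearMap.range (LinearMap.lTensor (FrobPush p e R) L.subtype)

theorem mul_tmul_mem_frobeniusPower {p : ℕ} [Fact p.Prime] [CharP R p] {e : ℕ}
    {L : Submodule R M} (a : R) {c : R} {z : M}
    (h : FrobPush.of p e c ⊗ₜ[R] z ∈ frobeniusPower p e L) :
    FrobPush.of p e (a * c) ⊗ₜ[R] z ∈ frobeniusPower p e L := by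
  obtain ⟨t, ht⟩ := h
  refine ⟨LinearMap.rTensor L (FrobPush.mulLeft p e a) t, ?_⟩
  have h2 := congrArg (LinearMap.rTensor M (FrobPush.mulLeft p e a)) ht
  rw [← LinearMap.comp_apply, LinearMap.rTensor_comp_lTensor] at h2
  rw [← LinearMap.comp_apply, LinearMap.lTensor_comp_rTensor, h2]
  rfl

/-- The tight closure `L^*_M` of `L` in `M`: all `z` for which some `c ∈ R°` satisfies
`c z ^ (p ^ e) ∈ L^{[p ^ e]}_M` for all large `e`. -/
def tightClosure (p : ℕ) [Fact p.Prime] [CharP R p] (L : Submodule R M) : Submodule R M where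
  carrier := {z | ∃ c ∈ ringCirc R, ∃ e₀ : ℕ, ∀ e ≥ e₀,
    FrobPush.of p e c ⊗ₜ[R] z ∈ frobeniusPower p e L}
  zero_mem' := ⟨1, one_mem_ringCirc R, 0, fun e _ => by
    rw [TensorProduct.tmul_zero]; exact zero_mem _⟩
  add_mem' := by
    rintro x y ⟨c, hc, m, hm⟩ ⟨d, hd, n, hn⟩
    refine ⟨c * d, mul_mem_ringCirc hc hd, max m n, fun e he => ?_⟩
    rw [TensorProduct.tmul_add]
    refine add_mem ?_ (mul_tmul_mem_frobeniusPower c (hn e (le_trans (le_max_right _ _) he)))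
    rw [mul_comm]
    exact mul_tmul_mem_frobeniusPower d (hm e (le_trans (le_max_left _ _) he))
  smul_mem' := by
    rintro r x ⟨c, hc, m, hm⟩
    refine ⟨c, hc, m, fun e he => ?_⟩
    rw [TensorProduct.tmul_smul]
    exact Submodule.smul_mem _ r (hm e he)

/-- The module closure `L^{cl_B}_M`: all `m` with `m ⊗ b ∈ im (L ⊗ B → M ⊗ B)` for all `b ∈ B`. -/
def moduleClosure (B : Type*) [AddCommGroup B] [Module R B] (L : Submodule R M) :
    Submodule R M where
  carrier := {m | ∀ b : B, m ⊗ₜ[R] b ∈ LinearMap.range (LinearMap.rTensor B L.subtype)}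
  zero_mem' b := by rw [TensorProduct.zero_tmul]; exact zero_mem _
  add_mem' hx hy b := by rw [TensorProduct.add_tmul]; exact add_mem (hx b) (hy b)
  smul_mem' r x hx b := by
    rw [← TensorProduct.smul_tmul']; exact Submodule.smul_mem _ r (hx b)

end Closures

/-- The tight interior `M_*` of an `R`-module `M`: the intersection over `c ∈ R°` and `e₀` of
`∑_{e ≥ e₀} im (Hom_R(F^e_* R, M) → M, g ↦ g (F^e_* c))`. -/
def tightInterior (p : ℕ) (R : Type*) [CommRing R] [Fact p.Prime] [CharP R p]
    (M : Type*) [AddCommGroup M] [Module R M] : Submodule R M :=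
  ⨅ c ∈ ringCirc R, ⨅ e₀ : ℕ, ⨆ e ≥ e₀,
    LinearMap.range (LinearMap.applyₗ (R := R) (M₂ := M) (FrobPush.of p e c))

/-- `W` is a durable test module for `R`: for all submodules `L` of `R`-modules `M`, `W ⊗ L` and
`W ⊗ L^*_M` have the same image in `W ⊗ M`. -/
def IsDurableTestModule (p : ℕ) (R : Type u) [CommRing R] [Fact p.Prime] [CharP R p]
    (W : Type w) [AddCommGroup W] [Module R W] : Prop :=
  ∀ (M : Type v) [AddCommGroup M] [Module R M] (L : Submodule R M),
    LinearMap.range (LinearMap.lTensor W L.subtype) =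
      LinearMap.range (LinearMap.lTensor W (tightClosure p L).subtype)

open CategoryTheory in
/-- `ω` is a canonical module of the domain `S`, i.e. the lowest cohomology module of a dualizing
complex of `S`: for a presentation of `S` as a quotient `A ⧸ P` of a regular ring `A` (so that
`RHom_A (S, A)` is a dualizing complex of `S`), `ω` is `S`-linearly isomorphic to
`Ext^c_A (S, A)`, where `c` is the height of `P`.  The action of `s ∈ S` on `Ext^c_A (S, A)` is
the one induced by multiplication by `s` on the first argument.  A canonical module is
unique up to tensoring with an invertible `S`-module. -/
def IsCanonicalModule (S : Type u) [CommRing S] [IsDomain S]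
    (ω : Type u) [AddCommGroup ω] [Module S ω] : Prop :=
  ∃ (A : Type u) (_ : CommRing A) (_ : IsRegularRing A) (_ : Algebra A S) (c : ℕ)
    (e : ω ≃+ Abelian.Ext (ModuleCat.of A S) (ModuleCat.of A A) c),
    Function.Surjective (algebraMap A S) ∧
    (RingHom.ker (algebraMap A S)).height = c ∧
    ∀ (s : S) (x : ω), e (s • x) =
      (Abelian.Ext.mk₀ (ModuleCat.ofHom (LinearMap.mulLeft A s))).comp (e x) (zero_add c)

/-- The parameter test submodule `τ(ω) ⊆ ω` of a canonical module `ω` of a domain `S`: the smallest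
nonzero submodule `J ⊆ ω` with `φ (F^e_* J) ⊆ J` for all `e` and all `φ ∈ Hom_S(F^e_* ω, ω)`.
(For `S` F-finite, `Hom_S(F^e_* ω, ω)` is locally generated, over the endomorphisms of `F^e_* ω`, by
the `e`-th iterate of the trace `F_* ω → ω` dual to Frobenius.) -/
def parameterTestSubmodule (p : ℕ) (S : Type*) [CommRing S] [Fact p.Prime] [CharP S p]
    (ω : Type*) [AddCommGroup ω] [Module S ω] : Submodule S ω :=
  sInf {J | J ≠ ⊥ ∧ ∀ (e : ℕ) (φ : FrobPush p e ω →ₗ[S] ω), ∀ x ∈ J, φ (FrobPush.of p e x) ∈ J}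

/-- The closure `L ↦ ⋂_S L^{cl_{τ(ω_S)}}_M`, where `S` runs over all module-finite domain extensions
of `R` and `ω_S` over the canonical modules of `S`; `τ(ω_S)` is regarded as an `R`-module.
As canonical modules of `S` are locally isomorphic to each other and a module closure depends on
its module only up to local isomorphism, all `ω_S` for a given `S` yield the same closure. -/
def parameterTestClosure (p : ℕ) [Fact p.Prime] {R : Type u} [CommRing R]
    {M : Type v} [AddCommGroup M] [Module R M] (L : Submodule R M) : Submodule R M :=
  sInf {N | ∃ (S : Type u) (_ : CommRing S) (_ : IsDomain S) (_ : CharP S p) (_ : Algebra R S)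
    (_ : Module.Finite R S) (_ : FaithfulSMul R S)
    (ω : Type u) (_ : AddCommGroup ω) (_ : Module S ω) (_ : Module R ω) (_ : IsScalarTower R S ω),
    IsCanonicalModule S ω ∧ N = moduleClosure (R := R) (parameterTestSubmodule p S ω) L}

/-!
# Tight closure as an intersection of module closures of parameter test modules

Let `R` be an F-finite Noetherian domain. Everything rests on two facts.

*Test elements.* There is `c ≠ 0` such that for every `d ≠ 0` and every `e₀`, `c` is a sum of
elements `φ (F^e_* d)` with `e ≥ e₀` and `φ ∈ Hom_R(F^e_* R, R)`
(`exists_forall_mem_traceSum`). Indeed, multiplication by some `b ≠ 0` on `F_* R` factors through a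
finite free module, and if all values `φ (F^e_* d)` lay in a prime `P` not containing `b`, then `d`
would lie in all `P ^ (p ^ e)` locally at `P`, against Krull's intersection theorem; so a power of
`b` is a sum of such values, and an exponent independent of `d` is obtained by applying a map
`F_* R → R` with value a power of `b` at `F_* 1`. Consequently
tight interiors are idempotent (`mem_tightInterior_tightInterior`), and a module `W` with `W_* = W`
is a durable test module: if `F^e_* c ⊗ z` lies in the image of `F^e_* R ⊗ L`, applying
`g : F^e_* R → W` shows that `g (F^e_* c) ⊗ z` lies in the image of `W ⊗ L`. The same computation
for a module over an extension `S` of `R` shows that tight closure is contained in the module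
closure given by `(ω_S)_*` (`tightClosure_le_moduleClosure`). As a canonical module is finite,
torsion-free and nonzero, functionals `ω_S → S` show that `(ω_S)_*` is the smallest nonzero
submodule compatible with the maps `F^e_* ω_S → ω_S`, so `(ω_S)_* = τ(ω_S)`
(`parameterTestSubmodule_eq_tightInterior`). That canonical modules are finite, torsion-free and
nonzero is a matter of the grade of an ideal of a regular ring being its height.

For the remaining inclusion, the module-finite extensions `F^e : R → R` suffice: if `z` lies in the
module closure for `F^e_* τ(ω_R)` for all `e`, fix `0 ≠ u ∈ τ(ω_R)` and a functional `h` with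
`h u ≠ 0`; then `F^e_* (h u) ⊗ z` lies in the image of `F^e_* R ⊗ L` for all `e`
(`parameterTestClosure_le_tightClosure`).

*Existence of canonical modules.* An F-finite Noetherian ring is a quotient of a regular ring
(`IsFFinite.exists_isRegularRing_surjective`, due to Gabber). If `x₁, …, xₙ` generate `R` over its
`p`-th powers, let `R_e = R[X] / (X i ^ (p ^ e) - x i)`, and let `A` be the limit of the surjections
`R_{e+1} → R_e` that are Frobenius on `R` and fix the `X i`. Then `A` surjects onto `R_0 = R`. The
`p`-th power of a compatible sequence is essentially its shift, and therefore the monomials in the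
`X i` with exponents below `p` form a basis of `A` over `A ^ p`. The kernel of `A → R_0` is finitely
generated and `A` is complete for it, so `A` is Noetherian (`isNoetherianRing_of_complete`, the
argument of Hilbert's basis theorem on leading forms). Finally `A` is regular by Kunz's theorem in
the easy direction: flatness of Frobenius makes the `p ^ e`-th powers of a minimal generating family
of the maximal ideal of a localization independent in the sense of Lech, whence that family is a
regular sequence (`FrobeniusDualBasis.isRegularRing`).
-/

/-! ### Test elements and trace sums over an F-finite domain -/

theorem mem_ringCirc_iff_ne_zero {R : Type*} [CommRing R] [IsDomain R] {c : R} :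
    c ∈ ringCirc R ↔ c ≠ 0 := by
  simp [ringCirc, IsDomain.minimalPrimes_eq_singleton_bot]

/-- Multiplication by a suitable nonzero scalar on a finite module over a domain factors through
a finite free module. -/
theorem exists_smul_eq_sum_smul (R : Type*) [CommRing R] [IsDomain R] (N : Type*)
    [AddCommGroup N] [Module R N] [Module.Finite R N] :
    ∃ c : R, c ≠ 0 ∧ ∃ (n : ℕ) (α : Fin n → N →ₗ[R] R) (v : Fin n → N),
      ∀ x, c • x = ∑ i, α i x • v i := by
  classical
  obtain ⟨m, s, hs⟩ := Module.Finite.exists_fin (R := R) (M := N)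
  obtain ⟨t, ht, hmax⟩ := exists_maximal_linearIndepOn R s
  have hc : ∀ i, ∃ a : R, a ≠ 0 ∧ a • s i ∈ Submodule.span R (s '' t) := fun i => by
    by_cases hi : i ∈ t
    · exact ⟨1, one_ne_zero, by
        rw [one_smul]; exact Submodule.subset_span ⟨i, hi, rfl⟩⟩
    · exact hmax i hi
  choose a ha0 ha using hc
  set c := ∏ i, a i
  have hall : ∀ x : N, c • x ∈ Submodule.span R (s '' t) := by
    intro x
    have hx : x ∈ Submodule.span R (Set.range s) := hs ▸ Submodule.mem_top
    induction hx using Submodule.span_induction with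
    | mem x h =>
      obtain ⟨i, rfl⟩ := h
      obtain ⟨b, hb⟩ := Finset.dvd_prod_of_mem a (Finset.mem_univ i)
      change (∏ i, a i) • s i ∈ _
      rw [hb, mul_comm, mul_smul]
      exact Submodule.smul_mem _ _ (ha i)
    | zero => simp
    | add x y _ _ hx hy => rw [smul_add]; exact add_mem hx hy
    | smul r x _ hx => rw [smul_comm]; exact Submodule.smul_mem _ _ hx
  have hrange : Set.range (fun i : t => s i) = s '' t := by
    ext; simp
  let f : N →ₗ[R] Submodule.span R (Set.range fun i : t => s i) :=
    (LinearMap.lsmul R N c).codRestrict _ (fun x => by rw [hrange]; exact hall x)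
  let e := Fintype.equivFin t
  have hli : LinearIndependent R (fun i : t => s i) := ht
  refine ⟨c, Finset.prod_ne_zero_iff.2 fun i _ => ha0 i, Fintype.card t,
    fun i => Finsupp.lapply (e.symm i) ∘ₗ hli.repr ∘ₗ f,
    fun i => s (e.symm i), fun x => ?_⟩
  have h := hli.linearCombination_repr (f x)
  rw [Finsupp.linearCombination_apply, Finsupp.sum_fintype _ _ (by simp)] at h
  rw [← e.sum_comp]
  simpa [f] using h.symm

/-- A nonzero element of a finite torsion-free module over a domain is detected by a functional. -/
theorem exists_linearMap_apply_ne_zero (R : Type*) [CommRing R] [IsDomain R] {N : Type*}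
    [AddCommGroup N] [Module R N] [Module.Finite R N] [Module.IsTorsionFree R N] {x : N}
    (hx : x ≠ 0) : ∃ f : N →ₗ[R] R, f x ≠ 0 := by
  obtain ⟨c, hc, n, α, v, h⟩ := exists_smul_eq_sum_smul R N
  by_contra! hf
  have := h x
  simp only [hf, zero_smul, Finset.sum_const_zero] at this
  exact (smul_ne_zero hc hx) this

namespace FrobPush

variable {p : ℕ} [Fact p.Prime] {R : Type*} [CommRing R] [CharP R p]
  {L M N : Type*} [AddCommGroup L] [Module R L] [AddCommGroup M] [Module R M]
  [AddCommGroup N] [Module R N]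

/-- The composite `g ∘ F^e_* φ : F^{e + f}_* L → N` of `g : F^e_* M → N` and `φ : F^f_* L → M`. -/
def comp {e f : ℕ} (g : FrobPush p e M →ₗ[R] N) (φ : FrobPush p f L →ₗ[R] M) :
    FrobPush p (e + f) L →ₗ[R] N where
  toFun x := g (of p e (φ (of p f ((of p (e + f)).symm x))))
  map_add' x y := by simp
  map_smul' r x := by
    obtain ⟨y, rfl⟩ := (of p (e + f)).surjective x
    rw [smul_of, AddEquiv.symm_apply_apply, AddEquiv.symm_apply_apply, pow_add, pow_mul,
      ← smul_of p f, map_smul, ← smul_of, map_smul, RingHom.id_apply]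

@[simp]
theorem mulLeft_of {e : ℕ} (a x : R) : mulLeft p e a (of p e x) = of p e (a * x) := rfl

/-- `F^0_* M` is `M`. -/
def zeroEquiv (p : ℕ) [Fact p.Prime] (R : Type*) [CommRing R] [CharP R p] (M : Type*)
    [AddCommGroup M] [Module R M] : FrobPush p 0 M ≃ₗ[R] M :=
  { (of p 0 (M := M)).symm with
    map_smul' r x := by
      obtain ⟨y, rfl⟩ := (of p 0).surjective x
      rw [smul_of]
      simp }

@[simp]
theorem zeroEquiv_of (x : M) : zeroEquiv p R M (of p 0 x) = x := rfl

instance isTorsionFree [IsDomain R] [Module.IsTorsionFree R M] (e : ℕ) :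
    Module.IsTorsionFree R (FrobPush p e M) := by
  rw [Module.isTorsionFree_iff_smul_eq_zero]
  intro r x h
  obtain ⟨y, rfl⟩ := (of p e).surjective x
  rw [smul_of, EmbeddingLike.map_eq_zero_iff, smul_eq_zero] at h
  rcases h with h | h
  · exact Or.inl (eq_zero_of_pow_eq_zero h)
  · exact Or.inr (by rw [h, map_zero])

end FrobPush

theorem IsFFinite.finite_iterateFrobenius {p : ℕ} [Fact p.Prime] {R : Type*} [CommRing R]
    [CharP R p] (h : IsFFinite p R) (e : ℕ) : (iterateFrobenius R p e).Finite := by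
  induction e with
  | zero =>
    rw [iterateFrobenius_zero]
    exact RingHom.Finite.id R
  | succ e ih =>
    have : iterateFrobenius R p (e + 1) = (iterateFrobenius R p e).comp (frobenius R p) := by
      ext x
      simp [iterateFrobenius_def, frobenius_def, pow_succ', pow_mul]
    rw [this]
    exact ih.comp h

theorem IsFFinite.finite_frobPush {p : ℕ} [Fact p.Prime] {R : Type*} [CommRing R] [CharP R p]
    (h : IsFFinite p R) (e : ℕ) : Module.Finite R (FrobPush p e R) :=
  h.finite_iterateFrobenius e

open FrobPush

section TestElements

variable (p : ℕ) [Fact p.Prime] {R : Type*} [CommRing R] [CharP R p]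

/-- `∑_{e ≥ e₀} im (Hom_R(F^e_* R, U) → U, g ↦ g (F^e_* c))`. -/
def traceSum (U : Type*) [AddCommGroup U] [Module R U] (c : R) (e₀ : ℕ) : Submodule R U :=
  ⨆ e ≥ e₀, LinearMap.range (LinearMap.applyₗ (R := R) (M₂ := U) (of p e c))

variable {p} {U : Type*} [AddCommGroup U] [Module R U]

theorem apply_of_mem_traceSum {c : R} {e₀ e : ℕ} (he : e₀ ≤ e) (g : FrobPush p e R →ₗ[R] U) :
    g (of p e c) ∈ traceSum p U c e₀ :=
  Submodule.mem_iSup_of_mem e (Submodule.mem_iSup_of_mem he ⟨g, rfl⟩)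

theorem traceSum_le_iff {c : R} {e₀ : ℕ} {J : Submodule R U} :
    traceSum p U c e₀ ≤ J ↔
      ∀ e ≥ e₀, ∀ g : FrobPush p e R →ₗ[R] U, g (of p e c) ∈ J := by
  simp only [traceSum, iSup_le_iff]
  exact forall₂_congr fun e _ => ⟨fun h g => h ⟨g, rfl⟩, by rintro h _ ⟨g, rfl⟩; exact h g⟩

theorem mem_tightInterior_iff [IsDomain R] {u : U} :
    u ∈ tightInterior p R U ↔ ∀ c : R, c ≠ 0 → ∀ e₀, u ∈ traceSum p U c e₀ := by
  simp only [tightInterior, Submodule.mem_iInf, mem_ringCirc_iff_ne_zero]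
  rfl

/-- The submodule `traceSum` is generated by the values `g (F^e_* c)` even as an additive monoid, so
that maps which are only additive or Frobenius-linear can be followed along a sum of values. -/
theorem traceSum_induction {c : R} {e₀ : ℕ} {C : U → Prop} {u : U} (hu : u ∈ traceSum p U c e₀)
    (mem : ∀ e ≥ e₀, ∀ g : FrobPush p e R →ₗ[R] U, C (g (of p e c))) (zero : C 0)
    (add : ∀ x y, C x → C y → C (x + y)) : C u := by
  let S : Set U := {x | ∃ e ≥ e₀, ∃ g : FrobPush p e R →ₗ[R] U, g (of p e c) = x}
  let J : Submodule R U :=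
    { AddSubmonoid.closure S with
      smul_mem' r x hx := by
        induction hx using AddSubmonoid.closure_induction with
        | mem x h =>
          obtain ⟨e, he, g, rfl⟩ := h
          exact AddSubmonoid.subset_closure ⟨e, he, r • g, rfl⟩
        | zero => rw [smul_zero]; exact (AddSubmonoid.closure S).zero_mem
        | add x y _ _ hx hy => rw [smul_add]; exact (AddSubmonoid.closure S).add_mem hx hy }
  have hJ : u ∈ AddSubmonoid.closure S :=
    traceSum_le_iff (J := J) |>.2
      (fun e he g => AddSubmonoid.subset_closure ⟨e, he, g, rfl⟩) hu
  clear hu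
  induction hJ using AddSubmonoid.closure_induction with
  | mem x h => obtain ⟨e, he, g, rfl⟩ := h; exact mem e he g
  | zero => exact zero
  | add x y _ _ hx hy => exact add x y hx hy

theorem apply_mem_traceSum {V : Type*} [AddCommGroup V] [Module R V] {c : R} {e₀ : ℕ}
    {u : U} (hu : u ∈ traceSum p U c e₀) {e : ℕ} (g : FrobPush p e U →ₗ[R] V) :
    g (of p e u) ∈ traceSum p V c e₀ := by
  refine traceSum_induction (C := fun u => g (of p e u) ∈ traceSum p V c e₀) hu
    (fun f hf φ => apply_of_mem_traceSum (le_add_left hf) (FrobPush.comp g φ)) (by simp)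
    fun x y hx hy => ?_
  rw [map_add, map_add]
  exact add_mem hx hy

variable [IsDomain R]

omit [IsDomain R] in
/-- If all functionals on `F^e_* R` send `F^e_* x` into the ideal `P`, then `x` lies in
`P ^ (p ^ e)` up to powers of an element `c` for which multiplication by `c` on `F_* R` factors
through a free module. -/
theorem pow_mul_mem_pow_of_forall_apply_mem {c : R} {n : ℕ}
    {α : Fin n → FrobPush p 1 R →ₗ[R] R} {v : Fin n → FrobPush p 1 R}
    (h : ∀ x, c • x = ∑ i, α i x • v i) (P : Ideal R) (e : ℕ) (x : R)
    (hx : ∀ φ : FrobPush p e R →ₗ[R] R, φ (of p e x) ∈ P) :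
    ∃ N, c ^ N * x ∈ P ^ p ^ e := by
  induction e generalizing x with
  | zero => exact ⟨0, by simpa using hx (zeroEquiv p R R).toLinearMap⟩
  | succ e ih =>
    have hi (i : Fin n) : ∃ N, c ^ N * α i (of p 1 x) ∈ P ^ p ^ e :=
      ih _ fun φ => hx (FrobPush.comp φ (α i))
    choose N hN using hi
    refine ⟨(∑ i, N i) * p + p, ?_⟩
    have hcx : c ^ p * x = ∑ i, (α i (of p 1 x)) ^ p * (of p 1).symm (v i) := by
      have := congrArg (of p 1).symm (h (of p 1 x))
      rw [smul_of, AddEquiv.symm_apply_apply, map_sum] at this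
      simp only [pow_one, smul_eq_mul] at this
      rw [this]
      refine Finset.sum_congr rfl fun i _ => ?_
      conv_lhs => rw [← (of p 1).apply_symm_apply (v i), smul_of]
      simp
    rw [pow_add c, mul_assoc, hcx, Finset.mul_sum]
    refine Ideal.sum_mem _ fun i _ => ?_
    rw [pow_mul c, ← mul_assoc, ← mul_pow, pow_succ, pow_mul P (p ^ e) p]
    refine Ideal.mul_mem_right _ _ (Ideal.pow_mem_pow ?_ p)
    obtain ⟨k, hk⟩ := Nat.exists_eq_add_of_le (Finset.single_le_sum (fun i _ => Nat.zero_le (N i))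
      (Finset.mem_univ i))
    rw [hk, pow_add, mul_comm (c ^ N i), mul_assoc]
    exact Ideal.mul_mem_left _ _ (hN i)

/-- Krull's intersection theorem at a prime `P`, without reference to the localization. -/
theorem eq_zero_of_forall_mul_mem_pow [IsNoetherianRing R] (P : Ideal R) [P.IsPrime] {x : R}
    (h : ∀ k : ℕ, ∃ s ∉ P, s * x ∈ P ^ k) : x = 0 := by
  have hx : algebraMap R (Localization.AtPrime P) x ∈
      (⨅ k : ℕ, IsLocalRing.maximalIdeal (Localization.AtPrime P) ^ k : Ideal _) := by
    rw [Submodule.mem_iInf]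
    intro k
    obtain ⟨s, hs, hsx⟩ := h k
    have := Ideal.mem_map_of_mem (algebraMap R (Localization.AtPrime P)) hsx
    rw [Ideal.map_pow, Localization.AtPrime.map_eq_maximalIdeal, map_mul] at this
    exact (Ideal.unit_mul_mem_iff_mem _
      (IsLocalization.map_units (Localization.AtPrime P) (⟨s, hs⟩ : P.primeCompl))).1 this
  rw [Ideal.iInf_pow_eq_bot_of_isLocalRing _ (Ideal.IsPrime.ne_top inferInstance),
    Ideal.mem_bot] at hx
  exact (IsLocalization.to_map_eq_zero_iff (Localization.AtPrime P)
    P.primeCompl_le_nonZeroDivisors).1 hx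

/-- F-finite Noetherian domains have (big) test elements: some `c ≠ 0` is a sum of elements
`φ (F^e_* d)`, `φ ∈ Hom_R(F^e_* R, R)`, for each `d ≠ 0`. -/
theorem exists_forall_mem_traceSum_zero [IsNoetherianRing R] (hR : IsFFinite p R) :
    ∃ c : R, c ≠ 0 ∧ ∀ d : R, d ≠ 0 → c ∈ traceSum p R d 0 := by
  have := hR.finite_frobPush 1
  obtain ⟨b, hb, n, α, v, h⟩ := exists_smul_eq_sum_smul R (FrobPush p 1 R)
  have hp : 2 ≤ p := (Fact.out : p.Prime).two_le
  have hpow (J : Ideal R) (H : ∀ P : Ideal R, P.IsPrime → J ≤ P → b ∉ P → False) :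
      ∃ k, b ^ k ∈ J := by
    by_contra! hk
    obtain ⟨P, hP, hJP, hdisj⟩ := Ideal.exists_le_prime_disjoint J (Submonoid.powers b)
      (Set.disjoint_left.2 fun x hx hx' => by
        obtain ⟨k, rfl⟩ := hx'; exact hk k hx)
    exact H P hP hJP fun hbP => Set.disjoint_left.1 hdisj hbP (Submonoid.mem_powers b)
  -- some power of `b` is a value `θ (F_* 1)`
  obtain ⟨k, θ, hθ⟩ := hpow (LinearMap.range (LinearMap.applyₗ (R := R) (M₂ := R) (of p 1 (1 : R))))
    fun P hP hJP hbP => by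
      obtain ⟨N, hN⟩ := pow_mul_mem_pow_of_forall_apply_mem h P 1 1 fun φ => hJP ⟨φ, rfl⟩
      rw [mul_one, pow_one] at hN
      exact hbP (hP.mem_of_pow_mem _ (Ideal.pow_le_self (by omega) hN))
  replace hθ : (b • θ) (of p 1 (1 : R)) = b ^ (k + 1) := by
    rw [pow_succ', ← hθ]; rfl
  generalize b • θ = θ at hθ
  refine ⟨(b ^ (k + 1)) ^ 3, pow_ne_zero _ (pow_ne_zero _ hb), fun d hd => ?_⟩
  obtain ⟨m, hm⟩ := hpow (traceSum p R d 0) fun P hP hJP hbP => hd <| by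
    refine eq_zero_of_forall_mul_mem_pow P fun j => ?_
    obtain ⟨N, hN⟩ := pow_mul_mem_pow_of_forall_apply_mem h P j d fun φ =>
      hJP (apply_of_mem_traceSum (Nat.zero_le _) φ)
    exact ⟨b ^ N, fun hmem => hbP (hP.mem_of_pow_mem _ hmem),
      Ideal.pow_le_pow_right (Nat.lt_pow_self hp).le hN⟩
  -- `θ` turns `(b ^ (k + 1)) ^ (p * j)` into `(b ^ (k + 1)) ^ (j + 1)`, which lowers any exponent
  -- above `3`
  have key : ∀ l : ℕ, (b ^ (k + 1)) ^ (l + 3) ∈ traceSum p R d 0 →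
      (b ^ (k + 1)) ^ 3 ∈ traceSum p R d 0 := by
    intro l
    induction l with
    | zero => exact fun h => h
    | succ l ih =>
      intro hl
      refine ih ?_
      have h1 : (b ^ (k + 1)) ^ (p * (l + 2)) ∈ traceSum p R d 0 := by
        obtain ⟨q, hq⟩ := Nat.exists_eq_add_of_le (show l + 1 + 3 ≤ p * (l + 2) by nlinarith)
        rw [hq, pow_add]
        exact Ideal.mul_mem_right _ _ hl
      have h2 := apply_mem_traceSum h1 θ
      have h3 : of p 1 ((b ^ (k + 1)) ^ (p * (l + 2))) =
          ((b ^ (k + 1)) ^ (l + 2)) • of p 1 (1 : R) := by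
        rw [smul_of, smul_eq_mul, mul_one, pow_one, mul_comm p, pow_mul]
      rwa [h3, map_smul, hθ, smul_eq_mul, ← pow_succ] at h2
  refine key m ?_
  obtain ⟨q, hq⟩ := Nat.exists_eq_add_of_le (show m ≤ (k + 1) * (m + 3) by nlinarith)
  rw [← pow_mul, hq, pow_add]
  exact Ideal.mul_mem_right _ _ hm

/-- Test elements in the form used for tight interiors: the exponents `e` may be taken
arbitrarily large. -/
theorem exists_forall_mem_traceSum [IsNoetherianRing R] (hR : IsFFinite p R) :
    ∃ c : R, c ≠ 0 ∧ ∀ d : R, d ≠ 0 → ∀ e₀, c ∈ traceSum p R d e₀ := by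
  obtain ⟨c, hc0, hc⟩ := exists_forall_mem_traceSum_zero hR
  refine ⟨c, hc0, fun d hd e₀ => ?_⟩
  have := hR.finite_frobPush e₀
  obtain ⟨θ, hθ⟩ := exists_linearMap_apply_ne_zero R (x := of p e₀ d) (by simpa using hd)
  refine traceSum_induction (C := (· ∈ traceSum p R d e₀)) (hc _ hθ) (fun e _ g => ?_)
    (zero_mem _) fun _ _ => add_mem
  exact apply_of_mem_traceSum (le_add_left le_rfl) (FrobPush.comp g θ)

/-- For a test element `c`, all values `g (F^e_* c)` lie in the tight interior. -/
theorem mem_tightInterior_of_mem_traceSum {c : R}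
    (hc : ∀ d : R, d ≠ 0 → ∀ e₀, c ∈ traceSum p R d e₀) {e₀ : ℕ} {u : U}
    (hu : u ∈ traceSum p U c e₀) : u ∈ tightInterior p R U := by
  rw [mem_tightInterior_iff]
  intro d hd e₁
  exact traceSum_induction (C := (· ∈ traceSum p U d e₁)) hu
    (fun e _ g => apply_mem_traceSum (hc d hd e₁) g) (zero_mem _) fun _ _ => add_mem

/-- The tight interior is idempotent. -/
theorem mem_tightInterior_tightInterior [IsNoetherianRing R] (hR : IsFFinite p R)
    (u : tightInterior p R U) : u ∈ tightInterior p R (tightInterior p R U) := by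
  obtain ⟨c, hc0, hc⟩ := exists_forall_mem_traceSum (p := p) hR
  obtain ⟨u, hu⟩ := u
  -- `u` is a sum of values `g (F^e_* (c * c))`; one factor `c` makes `g` take values in the tight
  -- interior, the other one makes these values lie in the tight interior of the tight interior
  have hu' := mem_tightInterior_iff.1 hu (c * c) (mul_ne_zero hc0 hc0) 0
  suffices ∀ h : u ∈ tightInterior p R U,
      (⟨u, h⟩ : tightInterior p R U) ∈ tightInterior p R (tightInterior p R U) from this hu
  have key : ∃ h : u ∈ tightInterior p R U,
      (⟨u, h⟩ : tightInterior p R U) ∈ tightInterior p R (tightInterior p R U) := by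
    refine traceSum_induction (C := fun u => ∃ h : u ∈ tightInterior p R U,
      (⟨u, h⟩ : tightInterior p R U) ∈ tightInterior p R (tightInterior p R U)) hu'
      (fun e _ g => ?_) ⟨zero_mem _, zero_mem _⟩ ?_
    · -- `x ↦ g (F^e_* (c * x))` has values in the tight interior
      let h : FrobPush p e R →ₗ[R] tightInterior p R U :=
        (g ∘ₗ mulLeft p e c).codRestrict _ fun x => by
          obtain ⟨x, rfl⟩ := (of p e).surjective x
          have : g (mulLeft p e c (of p e x)) = (g ∘ₗ mulLeft p e x) (of p e c) := by
            simp [mul_comm]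
          rw [LinearMap.comp_apply, this]
          exact mem_tightInterior_of_mem_traceSum hc (apply_of_mem_traceSum (Nat.zero_le _) _)
      exact ⟨_, mem_tightInterior_of_mem_traceSum hc
        (apply_of_mem_traceSum (e₀ := 0) (Nat.zero_le _) h)⟩
    · rintro x y ⟨hx, hx'⟩ ⟨hy, hy'⟩
      exact ⟨add_mem hx hy, add_mem hx' hy'⟩
  exact fun _ => key.2

end TestElements

/-! ### Tight interiors as durable test modules -/

section

open FrobPush

section Durable

variable {p : ℕ} [Fact p.Prime]

theorem tmul_mem_range_rTensor_iff {R : Type*} [CommRing R] {M B : Type*} [AddCommGroup M]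
    [Module R M] [AddCommGroup B] [Module R B] {L : Submodule R M} {m : M} {b : B} :
    m ⊗ₜ[R] b ∈ LinearMap.range (LinearMap.rTensor B L.subtype) ↔
      b ⊗ₜ[R] m ∈ LinearMap.range (LinearMap.lTensor B L.subtype) := by
  rw [← LinearMap.comm_comp_lTensor_comp_comm_eq, LinearMap.mem_range, LinearMap.mem_range]
  constructor
  · rintro ⟨t, ht⟩
    exact ⟨TensorProduct.comm R _ _ t, (TensorProduct.comm R _ _).injective (by simpa using ht)⟩
  · rintro ⟨t, ht⟩
    exact ⟨(TensorProduct.comm R _ _).symm t, by simp [ht]⟩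

theorem tmul_mem_range_lTensor_of_linearMap {R : Type*} [CommRing R] {M B C : Type*}
    [AddCommGroup M] [Module R M] [AddCommGroup B] [Module R B] [AddCommGroup C] [Module R C]
    {L : Submodule R M} (f : B →ₗ[R] C) {m : M} {b : B}
    (h : b ⊗ₜ[R] m ∈ LinearMap.range (LinearMap.lTensor B L.subtype)) :
    f b ⊗ₜ[R] m ∈ LinearMap.range (LinearMap.lTensor C L.subtype) := by
  obtain ⟨t, ht⟩ := h
  refine ⟨LinearMap.rTensor L f t, ?_⟩
  have h2 := congrArg (LinearMap.rTensor M f) ht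
  rw [← LinearMap.comp_apply, LinearMap.rTensor_comp_lTensor] at h2
  rw [← LinearMap.comp_apply, LinearMap.lTensor_comp_rTensor, h2, LinearMap.rTensor_tmul]

theorem le_tightClosure {R : Type*} [CommRing R] [CharP R p] {M : Type*} [AddCommGroup M]
    [Module R M] (L : Submodule R M) : L ≤ tightClosure p L := fun x hx =>
  ⟨1, one_mem_ringCirc R, 0, fun e _ => ⟨of p e 1 ⊗ₜ ⟨x, hx⟩, by simp⟩⟩

/-- If `S` is an extension of `R` and `W` is an `S`-module with `W_* = W`, then tensoring with `W`
over `R` does not distinguish `L` from its tight closure over `R`. -/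
theorem tmul_mem_range_of_mem_tightClosure {R : Type*} [CommRing R] [IsDomain R] [CharP R p]
    {S : Type*} [CommRing S] [IsDomain S] [CharP S p] [Algebra R S] [FaithfulSMul R S]
    {W : Type*} [AddCommGroup W] [Module S W] [Module R W] [IsScalarTower R S W]
    {M : Type*} [AddCommGroup M] [Module R M] {L : Submodule R M} {z : M}
    (hz : z ∈ tightClosure p L) {w : W} (hw : w ∈ tightInterior p S W) :
    w ⊗ₜ[R] z ∈ LinearMap.range (LinearMap.lTensor W L.subtype) := by
  obtain ⟨c, hc, e₀, hcz⟩ := hz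
  have hc' : algebraMap R S c ≠ 0 := by
    rw [Ne, FaithfulSMul.algebraMap_eq_zero_iff]
    exact mem_ringCirc_iff_ne_zero.1 hc
  refine traceSum_induction
    (C := fun w => w ⊗ₜ[R] z ∈ LinearMap.range (LinearMap.lTensor W L.subtype))
    (mem_tightInterior_iff.1 hw _ hc' e₀) (fun e he g => ?_)
    (by rw [TensorProduct.zero_tmul]; exact zero_mem _)
    fun x y hx hy => by rw [TensorProduct.add_tmul]; exact add_mem hx hy
  let f : FrobPush p e R →ₗ[R] W :=
    { toFun := fun x => g (of p e (algebraMap R S ((of p e).symm x)))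
      map_add' := fun x y => by simp
      map_smul' := fun r x => by
        obtain ⟨y, rfl⟩ := (of p e).surjective x
        rw [smul_of, AddEquiv.symm_apply_apply, AddEquiv.symm_apply_apply, smul_eq_mul, map_mul,
          map_pow, ← smul_eq_mul, ← smul_of, map_smul, algebraMap_smul, RingHom.id_apply] }
  exact tmul_mem_range_lTensor_of_linearMap f (hcz e he)

/-- A module that is its own tight interior is a durable test module. -/
theorem isDurableTestModule_of_forall_mem_tightInterior {R : Type u} [CommRing R] [IsDomain R]
    [CharP R p] {W : Type w} [AddCommGroup W] [Module R W] (hW : ∀ x : W, x ∈ tightInterior p R W) :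
    IsDurableTestModule.{u, v, w} p R W := by
  intro M _ _ L
  apply le_antisymm
  · rintro _ ⟨t, rfl⟩
    refine ⟨LinearMap.lTensor W (Submodule.inclusion (le_tightClosure L)) t, ?_⟩
    rw [← LinearMap.comp_apply, ← LinearMap.lTensor_comp, Submodule.subtype_comp_inclusion]
  · rintro _ ⟨t, rfl⟩
    induction t with
    | zero => simp
    | tmul x y => exact tmul_mem_range_of_mem_tightClosure (S := R) y.2 (hW x)
    | add x y hx hy => rw [map_add]; exact add_mem hx hy

theorem isDurableTestModule_tightInterior {R : Type u} [CommRing R] [IsDomain R]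
    [IsNoetherianRing R] [CharP R p] (hR : IsFFinite p R) (U : Type w) [AddCommGroup U]
    [Module R U] : IsDurableTestModule.{u, v, w} p R (tightInterior p R U) :=
  isDurableTestModule_of_forall_mem_tightInterior (mem_tightInterior_tightInterior hR)

end Durable

section ParameterTestSubmodule

variable {p : ℕ} [Fact p.Prime] {S : Type*} [CommRing S] [IsDomain S] [IsNoetherianRing S]
  [CharP S p] (hS : IsFFinite p S) {ω : Type*} [AddCommGroup ω] [Module S ω]

include hS in
theorem tightInterior_ne_bot [Module.IsTorsionFree S ω] [Nontrivial ω] :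
    tightInterior p S ω ≠ ⊥ := by
  obtain ⟨c, hc0, hc⟩ := exists_forall_mem_traceSum (p := p) hS
  obtain ⟨x, hx⟩ := exists_ne (0 : ω)
  refine (Submodule.ne_bot_iff _).2 ⟨c • x, mem_tightInterior_of_mem_traceSum hc
    (apply_of_mem_traceSum (e := 0) (Nat.zero_le _)
      (LinearMap.toSpanSingleton S ω x ∘ₗ (zeroEquiv p S S).toLinearMap)), smul_ne_zero hc0 hx⟩

/-- For a finite torsion-free module `ω ≠ 0`, e.g. a canonical module, the tight interior is the
smallest nonzero submodule compatible with all maps `F^e_* ω → ω`: a functional `h : ω → S` with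
`h j ≠ 0` turns any `g : F^e_* S → ω` into `g ∘ F^e_* h : F^e_* ω → ω`, with value
`g (F^e_* (h j))` at `F^e_* j`. -/
theorem parameterTestSubmodule_eq_tightInterior (hS : IsFFinite p S) [Module.Finite S ω]
    [Module.IsTorsionFree S ω] [Nontrivial ω] :
    parameterTestSubmodule p S ω = tightInterior p S ω := by
  apply le_antisymm
  · refine sInf_le ⟨tightInterior_ne_bot hS, fun e φ x hx => ?_⟩
    rw [mem_tightInterior_iff] at hx ⊢
    exact fun c hc e₀ => apply_mem_traceSum (hx c hc e₀) φ
  · refine le_sInf fun J hJ => ?_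
    obtain ⟨hJ0, hJ⟩ := hJ
    obtain ⟨j, hjJ, hj⟩ := (Submodule.ne_bot_iff _).1 hJ0
    obtain ⟨h, hh⟩ := exists_linearMap_apply_ne_zero S hj
    intro u hu
    refine traceSum_le_iff.2 (fun e _ g => ?_) (mem_tightInterior_iff.1 hu (h j) hh 0)
    exact hJ e (FrobPush.comp g (h ∘ₗ (zeroEquiv p S ω).toLinearMap)) j hjJ

end ParameterTestSubmodule

section Comparison

variable {p : ℕ} [Fact p.Prime]

theorem IsFFinite.of_finite {R : Type*} [CommRing R] [CharP R p]
    (hR : IsFFinite p R) (S : Type*) [CommRing S] [CharP S p] [Algebra R S] [Module.Finite R S] :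
    IsFFinite p S := by
  have h : ((frobenius S p).comp (algebraMap R S)).Finite := by
    have : (frobenius S p).comp (algebraMap R S) = (algebraMap R S).comp (frobenius R p) := by
      ext x; simp [frobenius_def]
    rw [this]
    exact RingHom.Finite.comp (RingHom.finite_algebraMap.2 inferInstance) hR
  exact h.of_comp_finite

/-- If `z` is in the module closure of `L` with respect to all `F^e_* τ`, for a nonzero submodule
`τ` of a finite torsion-free module, then `z` is in the tight closure: push a fixed element
`u ∈ τ` forward along a functional `h` with `h u ≠ 0`. -/
theorem mem_tightClosure_of_forall_mem_moduleClosure {R : Type*} [CommRing R] [IsDomain R]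
    [CharP R p] {τ : Type*} [AddCommGroup τ] [Module R τ] [Module.Finite R τ]
    [Module.IsTorsionFree R τ] [Nontrivial τ] {M : Type*} [AddCommGroup M] [Module R M]
    {L : Submodule R M} {z : M} (hz : ∀ e, z ∈ moduleClosure (FrobPush p e τ) L) :
    z ∈ tightClosure p L := by
  obtain ⟨u, hu⟩ := exists_ne (0 : τ)
  obtain ⟨h, hh⟩ := exists_linearMap_apply_ne_zero R hu
  refine ⟨h u, mem_ringCirc_iff_ne_zero.2 hh, 0, fun e _ => ?_⟩
  let f : FrobPush p e τ →ₗ[R] FrobPush p e R :=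
    { toFun := fun x => of p e (h ((of p e).symm x))
      map_add' := fun x y => by simp
      map_smul' := fun r x => by
        obtain ⟨y, rfl⟩ := (of p e).surjective x
        rw [smul_of, AddEquiv.symm_apply_apply, AddEquiv.symm_apply_apply, map_smul,
          RingHom.id_apply, smul_of] }
  exact tmul_mem_range_lTensor_of_linearMap f (tmul_mem_range_rTensor_iff.1 (hz e (of p e u)))

/-- The extensions of `R` given by the iterates of Frobenius already cut out the tight closure. -/
theorem parameterTestClosure_le_tightClosure {R : Type u} [CommRing R] [IsDomain R]
    [IsNoetherianRing R] [CharP R p] (hR : IsFFinite p R) {ω : Type u} [AddCommGroup ω]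
    [Module R ω] [Module.Finite R ω] [Module.IsTorsionFree R ω] [Nontrivial ω]
    (hω : IsCanonicalModule R ω) {M : Type v} [AddCommGroup M] [Module R M] (L : Submodule R M) :
    parameterTestClosure p L ≤ tightClosure p L := by
  intro z hz
  have hne : parameterTestSubmodule p R ω ≠ ⊥ :=
    parameterTestSubmodule_eq_tightInterior (ω := ω) hR ▸ tightInterior_ne_bot hR
  have : Nontrivial (parameterTestSubmodule p R ω) := Submodule.nontrivial_iff_ne_bot.2 hne
  refine mem_tightClosure_of_forall_mem_moduleClosure (τ := parameterTestSubmodule p R ω)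
    fun e => ?_
  rw [parameterTestClosure, Submodule.mem_sInf] at hz
  refine hz _ ?_
  -- `R` as an extension of itself along the iterate of Frobenius
  have hfin : @Module.Finite R R _ _ (iterateFrobenius R p e).toAlgebra.toModule :=
    hR.finite_iterateFrobenius e
  have hfaith : @FaithfulSMul R R (iterateFrobenius R p e).toAlgebra.toSMul :=
    (@faithfulSMul_iff_algebraMap_injective R R _ _ (iterateFrobenius R p e).toAlgebra).2
      (iterateFrobenius_inj R p e)
  have htower : @IsScalarTower R R ω (iterateFrobenius R p e).toAlgebra.toSMul _
      (Module.compHom ω (iterateFrobenius R p e)).toSMul :=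
    @IsScalarTower.mk R R ω (iterateFrobenius R p e).toAlgebra.toSMul _
      (Module.compHom ω (iterateFrobenius R p e)).toSMul
      fun r s x => mul_smul (iterateFrobenius R p e r) s x
  exact ⟨R, ‹_›, ‹_›, ‹_›, (iterateFrobenius R p e).toAlgebra, hfin, hfaith,
    ω, ‹_›, ‹_›, Module.compHom ω (iterateFrobenius R p e), htower, hω, rfl⟩

theorem tightClosure_le_moduleClosure {R : Type u} [CommRing R] [IsDomain R] [CharP R p]
    {S : Type u} [CommRing S] [IsDomain S] [IsNoetherianRing S] [CharP S p]
    (hS : IsFFinite p S) [Algebra R S] [FaithfulSMul R S] {ω : Type u} [AddCommGroup ω]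
    [Module S ω] [Module R ω] [IsScalarTower R S ω] [Module.Finite S ω]
    [Module.IsTorsionFree S ω] [Nontrivial ω] {M : Type v} [AddCommGroup M] [Module R M]
    (L : Submodule R M) :
    tightClosure p L ≤ moduleClosure (R := R) (parameterTestSubmodule p S ω) L := by
  rw [parameterTestSubmodule_eq_tightInterior hS]
  exact fun z hz b => tmul_mem_range_rTensor_iff.2
    (tmul_mem_range_of_mem_tightClosure hz (mem_tightInterior_tightInterior hS b))

end Comparison

end

/-! ### Regular local rings and heights -/

section

open IsLocalRing RingTheory.Sequence CategoryTheory Abelian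
open scoped Pointwise

section RegularLocalRing

/-- In a Noetherian local ring, an element `x ∈ 𝔪 \ 𝔪 ^ 2` is part of a minimal generating set of
`𝔪`. -/
theorem spanFinrank_maximalIdeal_quotient_add_one_le {R : Type*} [CommRing R] [IsLocalRing R]
    [IsNoetherianRing R] {x : R} (hx : x ∈ maximalIdeal R) (hx2 : x ∉ maximalIdeal R ^ 2)
    [IsLocalRing (R ⧸ Ideal.span {x})] :
    (maximalIdeal (R ⧸ Ideal.span {x})).spanFinrank + 1 ≤ (maximalIdeal R).spanFinrank := by
  classical
  obtain ⟨G, hG, hspan⟩ := Submodule.FG.exists_span_finset_card_eq_spanFinrank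
    (maximalIdeal R).fg_of_isNoetherianRing
  have hx' := hx
  rw [← hspan, Submodule.mem_span_finset] at hx'
  obtain ⟨f, -, hf⟩ := hx'
  have hGm : ∀ g ∈ G, g ∈ maximalIdeal R := fun g hg => hspan ▸ Submodule.subset_span hg
  obtain ⟨g, hgG, hg⟩ : ∃ g ∈ G, f g ∉ maximalIdeal R := by
    by_contra! h
    refine hx2 (hf ▸ Ideal.sum_mem _ fun a ha => ?_)
    rw [pow_two]
    exact Ideal.mul_mem_mul (h a ha) (hGm a ha)
  have hunit : IsUnit (f g) := by simpa using hg
  set π := Ideal.Quotient.mk (Ideal.span {x})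
  have hπx : π x = 0 := Ideal.Quotient.eq_zero_iff_mem.2 (Ideal.mem_span_singleton_self x)
  have hle : maximalIdeal (R ⧸ Ideal.span {x}) ≤
      Ideal.span (((G.erase g).image π : Finset _) : Set (R ⧸ Ideal.span {x})) := by
    intro y hy
    obtain ⟨y, rfl⟩ := Ideal.Quotient.mk_surjective y
    have hy : y ∈ maximalIdeal R := by
      rw [mem_maximalIdeal, mem_nonunits_iff] at hy ⊢
      exact fun h => hy (h.map π)
    have hmem : ∀ a ∈ G, π a ∈ Ideal.span (((G.erase g).image π : Finset _) : Set _) := by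
      intro a ha
      by_cases hag : a = g
      · subst hag
        rw [← Finset.add_sum_erase _ _ ha] at hf
        have h2 := congrArg π hf
        rw [hπx, map_add, map_sum, smul_eq_mul, map_mul, add_eq_zero_iff_eq_neg] at h2
        refine (Ideal.unit_mul_mem_iff_mem _ (hunit.map π)).1 ?_
        rw [h2]
        refine neg_mem (Ideal.sum_mem _ fun b hb => ?_)
        rw [smul_eq_mul, map_mul]
        exact Ideal.mul_mem_left _ _ (Ideal.subset_span
          (Finset.mem_coe.2 (Finset.mem_image_of_mem π hb)))
      · exact Ideal.subset_span (Finset.mem_coe.2 (Finset.mem_image_of_mem π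
          (Finset.mem_erase.2 ⟨hag, ha⟩)))
    rw [← hspan] at hy
    exact (Submodule.span_le.2 hmem : Submodule.span R (G : Set R) ≤ (Ideal.span _).comap π) hy
  have heq : maximalIdeal (R ⧸ Ideal.span {x}) =
      Ideal.span (((G.erase g).image π : Finset _) : Set (R ⧸ Ideal.span {x})) := by
    refine le_antisymm hle (Ideal.span_le.2 fun y hy => ?_)
    obtain ⟨a, ha, rfl⟩ := Finset.mem_image.1 (Finset.mem_coe.1 hy)
    rw [SetLike.mem_coe, mem_maximalIdeal, mem_nonunits_iff]
    intro hu
    obtain ⟨b, hb⟩ := hu.exists_right_inv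
    obtain ⟨b, rfl⟩ := Ideal.Quotient.mk_surjective b
    rw [← map_mul, ← map_one π, Ideal.Quotient.eq] at hb
    have h1 := (Ideal.span_singleton_le_iff_mem _).2 hx hb
    exact (Ideal.ne_top_iff_one _).1 (maximalIdeal.isMaximal R).ne_top
      ((Submodule.sub_mem_iff_right _ (Ideal.mul_mem_right b _
        (hGm a (Finset.mem_of_mem_erase ha)))).1 h1)
  have h1 := Submodule.spanFinrank_span_le_ncard_of_finite (R := R ⧸ Ideal.span {x})
    (((G.erase g).image π).finite_toSet)
  rw [Set.ncard_coe_finset] at h1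
  have h2 : ((G.erase g).image π).card ≤ (G.erase g).card := Finset.card_image_le
  rw [heq, ← hG, ← Finset.card_erase_add_one hgG]
  exact Nat.add_le_add_right (h1.trans h2) 1

/-- A regular local ring of dimension `n` is a domain, and its maximal ideal contains a regular
sequence of length `n`. -/
theorem isDomain_and_exists_isRegular_of_isRegularLocalRing (n : ℕ) :
    ∀ (R : Type u) [CommRing R] [IsRegularLocalRing R], ringKrullDim R = n →
      IsDomain R ∧ ∃ rs : List R, rs.length = n ∧ (∀ r ∈ rs, r ∈ maximalIdeal R) ∧
        IsWeaklyRegular R rs := by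
  induction n with
  | zero =>
    intro R _ _ hdim
    have h := IsRegularLocalRing.spanFinrank_maximalIdeal (R := R)
    rw [hdim, Nat.cast_inj, Submodule.spanFinrank_eq_zero_iff_eq_bot
      (maximalIdeal R).fg_of_isNoetherianRing] at h
    exact ⟨(isField_iff_maximalIdeal_eq.2 h).isDomain, [], rfl, by simp, .nil R R⟩
  | succ n ih =>
    intro R _ _ hdim
    have hrank := IsRegularLocalRing.spanFinrank_maximalIdeal (R := R)
    rw [hdim, Nat.cast_inj] at hrank
    have hfg := (maximalIdeal R).fg_of_isNoetherianRing
    have hm2 : ¬ maximalIdeal R ≤ maximalIdeal R ^ 2 := by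
      intro h
      have := Submodule.eq_bot_of_le_smul_of_le_jacobson_bot (maximalIdeal R) (maximalIdeal R) hfg
        (by rwa [smul_eq_mul, ← pow_two]) (maximalIdeal_le_jacobson _)
      rw [this, Submodule.spanFinrank_bot] at hrank
      omega
    have hmin : ∀ P ∈ minimalPrimes R, ¬ maximalIdeal R ≤ P := by
      intro P hP h
      have := hP.isPrime
      have hPm : P = maximalIdeal R := le_antisymm (le_maximalIdeal hP.isPrime.ne_top) h
      have h0 : (maximalIdeal R).height = 0 := by
        rw [← hPm]; exact Ideal.height_eq_zero_iff.2 hP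
      have := maximalIdeal_height_eq_ringKrullDim (R := R)
      rw [h0, hdim] at this
      exact absurd this (by norm_cast)
    obtain ⟨x, hxm, hx2, hxmin⟩ : ∃ x ∈ maximalIdeal R, x ∉ maximalIdeal R ^ 2 ∧
        ∀ P ∈ minimalPrimes R, x ∉ P := by
      have hfin := minimalPrimes.finite_of_isNoetherianRing R
      have := (Ideal.subset_union_prime_finite (hfin.insert (maximalIdeal R ^ 2)) (f := id)
        (maximalIdeal R ^ 2) (maximalIdeal R ^ 2) (I := maximalIdeal R)
        (fun i hi hi' _ => ((Set.mem_insert_iff.1 hi).resolve_left hi').isPrime)).not.2 (by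
          rintro ⟨i, hi, hle⟩
          rcases Set.mem_insert_iff.1 hi with rfl | hi
          · exact hm2 hle
          · exact hmin i hi hle)
      obtain ⟨x, hx, hx'⟩ := Set.not_subset.1 this
      simp only [id, Set.mem_iUnion, not_exists, Set.mem_insert_iff] at hx'
      exact ⟨x, hx, fun h => hx' _ (Or.inl rfl) h, fun P hP h => hx' P (Or.inr hP) h⟩
    have : Nontrivial (R ⧸ Ideal.span {x}) := Ideal.Quotient.nontrivial_iff.2 fun h => by
      exact (mem_maximalIdeal x).1 hxm (Ideal.span_singleton_eq_top.1 h)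
    have : IsLocalRing (R ⧸ Ideal.span {x}) :=
      .of_surjective' (Ideal.Quotient.mk _) Ideal.Quotient.mk_surjective
    have hrank' := spanFinrank_maximalIdeal_quotient_add_one_le hxm hx2
    have hdim1 : (n : WithBot ℕ∞) ≤ ringKrullDim (R ⧸ Ideal.span {x}) := by
      have := ringKrullDim_le_ringKrullDim_quotient_add_card (R := R) {x} (by
        rw [ringJacobson_eq_maximalIdeal]; simpa using hxm)
      rw [Finset.coe_singleton, Finset.card_singleton, hdim] at this
      push_cast at this
      exact ENat.WithBot.add_le_add_one_right_iff.1 this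
    have hdim2 := ringKrullDim_le_spanFinrank_maximalIdeal (R ⧸ Ideal.span {x})
    have hle : (maximalIdeal (R ⧸ Ideal.span {x})).spanFinrank ≤ n := by omega
    have hdim' : ringKrullDim (R ⧸ Ideal.span {x}) = n :=
      le_antisymm (hdim2.trans (by exact_mod_cast hle)) hdim1
    have : IsRegularLocalRing (R ⧸ Ideal.span {x}) :=
      .of_spanFinrank_maximalIdeal_le _ (hdim'.symm ▸ by exact_mod_cast hle)
    obtain ⟨hdom, rs, hlen, hmem, hreg⟩ := ih (R ⧸ Ideal.span {x}) hdim'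
    have hxprime : (Ideal.span {x}).IsPrime := (Ideal.Quotient.isDomain_iff_prime _).1 hdom
    have hdomR : IsDomain R := by
      obtain ⟨P, hP, hPx⟩ := Ideal.exists_minimalPrimes_le (I := ⊥) (J := Ideal.span {x}) bot_le
      have hPp := hP.isPrime
      have hxP := hxmin P hP
      have : P = ⊥ := by
        refine Submodule.eq_bot_of_le_smul_of_le_jacobson_bot (Ideal.span {x}) P
          P.fg_of_isNoetherianRing (fun a ha => ?_)
          ((Ideal.span_singleton_le_iff_mem _).2 (maximalIdeal_le_jacobson _ hxm))
        obtain ⟨b, rfl⟩ := Ideal.mem_span_singleton.1 (hPx ha)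
        exact Ideal.mul_mem_mul (Ideal.mem_span_singleton_self x)
          ((hPp.mem_or_mem ha).resolve_left hxP)
      rw [this] at hPp
      exact IsDomain.of_bot_isPrime R
    refine ⟨hdomR, ?_⟩
    obtain ⟨rs', rfl⟩ := (List.map_surjective_iff.2 (Ideal.Quotient.mk_surjective)) rs
    refine ⟨x :: rs', by simpa using hlen, ?_, ?_⟩
    · intro r hr
      rcases List.mem_cons.1 hr with rfl | hr
      · exact hxm
      · have := hmem _ (List.mem_map_of_mem hr)
        rw [mem_maximalIdeal, mem_nonunits_iff] at this ⊢
        exact fun h => this (h.map _)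
    · rw [isWeaklyRegular_cons_iff]
      have hx0 : x ≠ 0 := fun h => hx2 (h ▸ zero_mem _)
      refine ⟨IsSMulRegular.of_right_eq_zero_of_smul fun a ha => by simpa [hx0] using ha, ?_⟩
      exact (LinearEquiv.isWeaklyRegular_congr (Submodule.quotEquivOfEq (Ideal.span {x})
        (x • (⊤ : Submodule R R)) (by simp [← Submodule.ideal_span_singleton_smul])) rs').1
        ((isWeaklyRegular_map_algebraMap_iff (R ⧸ Ideal.span {x}) _ rs').1 hreg)

end RegularLocalRing

section Unmixed

/-- Dividing out a regular sequence of length `n` lowers the first degree in which `Ext(N, -)` is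
nonzero by at most `n`. -/
theorem subsingleton_linearMap_quotient_of_isWeaklyRegular {R : Type u} [CommRing R]
    (N : ModuleCat.{u} R) (rs : List R) :
    ∀ (M : ModuleCat.{u} R), IsWeaklyRegular M rs → (∀ i ≤ rs.length, Subsingleton (Ext N M i)) →
      Subsingleton (N →ₗ[R] M ⧸ (Ideal.ofList rs • ⊤ : Submodule R M)) := by
  induction rs with
  | nil =>
    intro M _ h
    have := h 0 le_rfl
    have : Subsingleton (N →ₗ[R] M) :=
      (Ext.addEquiv₀.trans ModuleCat.homAddEquiv).symm.injective.subsingleton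
    exact (LinearEquiv.congrRight (Submodule.quotEquivOfEqBot
      (Ideal.ofList [] • (⊤ : Submodule R M)) (by rw [Ideal.ofList_nil, Submodule.bot_smul])) :
        (N →ₗ[R] _) ≃ₗ[R] _).injective.subsingleton
  | cons x rs ih =>
    intro M hreg h
    rw [isWeaklyRegular_cons_iff] at hreg
    have := ih (ModuleCat.of R (QuotSMulTop x M)) hreg.2 fun i hi => by
      have zero1 := AddCommGrpCat.isZero_of_iff_subsingleton.mpr
        (h i (by rw [List.length_cons]; omega))
      have zero2 := AddCommGrpCat.isZero_of_iff_subsingleton.mpr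
        (h (i + 1) (by rw [List.length_cons]; omega))
      exact AddCommGrpCat.subsingleton_of_isZero <| ShortComplex.Exact.isZero_of_both_zeros
        ((Ext.covariant_sequence_exact₃' N hreg.1.smulShortComplex_shortExact) i (i + 1) rfl)
        (zero1.eq_zero_of_src _) (zero2.eq_zero_of_tgt _)
    exact (LinearEquiv.congrRight (Submodule.quotOfListConsSMulTopEquivQuotSMulTopInner M x rs) :
      (N →ₗ[R] _) ≃ₗ[R] _).injective.subsingleton

/-- Unmixedness of regular rings: a prime associated to the ideal of a regular sequence of length
`n` has height at most `n`. -/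
theorem height_le_length_of_isWeaklyRegular {A : Type u} [CommRing A] [IsRegularRing A]
    {rs : List A} (hrs : IsWeaklyRegular A rs) (q : Ideal A) [q.IsPrime] (a : A)
    (ha : ∀ s, s ∈ q ↔ s * a ∈ Ideal.ofList rs) : q.height ≤ rs.length := by
  set B := Localization.AtPrime q
  have hrsq : ∀ r ∈ rs, r ∈ q := fun r hr =>
    (ha r).2 (Ideal.mul_mem_right _ _ (Ideal.subset_span hr))
  by_contra! hlt
  obtain ⟨d, hd⟩ : ∃ d : ℕ, q.height = d := ENat.ne_top_iff_exists.1 (Ideal.height_ne_top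
    (Ideal.IsPrime.ne_top inferInstance)) |>.imp fun _ h => h.symm
  rw [hd, Nat.cast_lt] at hlt
  have hdim : ringKrullDim B = d := by
    rw [IsLocalization.AtPrime.ringKrullDim_eq_height q B, hd]; rfl
  obtain ⟨-, ys, hlen, hmem, hys⟩ := isDomain_and_exists_isRegular_of_isRegularLocalRing d B hdim
  have hys' : IsRegular B ys :=
    (isRegular_iff_isWeaklyRegular_of_subset_maximalIdeal hmem).2 hys
  have hvan := ModuleCat.subsingleton_ext_of_exists_isRegular (maximalIdeal B)
    (ModuleCat.of B (B ⧸ maximalIdeal B)) (by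
      rw [Module.support_eq_zeroLocus, Ideal.annihilator_quotient]) (ModuleCat.of B B) (by
      rw [smul_eq_mul, Ideal.mul_top]; exact (maximalIdeal.isMaximal B).ne_top.lt_top) ys hmem hys'
  have hreg : IsWeaklyRegular B (rs.map (algebraMap A B)) :=
    hrs.of_isLocalization B q.primeCompl
  have hsub := subsingleton_linearMap_quotient_of_isWeaklyRegular
    (ModuleCat.of B (B ⧸ maximalIdeal B)) (rs.map (algebraMap A B)) (ModuleCat.of B B) hreg
    fun i hi => hvan i (by rw [hlen]; rw [List.length_map] at hi; omega)
  obtain ⟨r, hr, hrreg⟩ := IsSMulRegular.subsingleton_linearMap_iff.1 hsub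
  rw [Ideal.annihilator_quotient] at hr
  have heq : Ideal.ofList (rs.map (algebraMap A B)) • (⊤ : Ideal B) =
      (Ideal.ofList rs).map (algebraMap A B) := by
    rw [smul_eq_mul, Ideal.mul_top, Ideal.map_ofList]
  have hmem := mem_of_isSMulRegular_quotient_of_smul_mem (x := algebraMap A B a) hrreg (by
    change r * algebraMap A B a ∈ Ideal.ofList (rs.map (algebraMap A B)) • (⊤ : Ideal B)
    rw [heq]
    rw [← Localization.AtPrime.map_eq_maximalIdeal] at hr
    have hle : (q.map (algebraMap A B)) ≤
        ((Ideal.ofList rs).map (algebraMap A B)).colon {algebraMap A B a} := by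
      rw [Ideal.map_le_iff_le_comap]
      intro s hs
      rw [Ideal.mem_comap, Submodule.mem_colon_singleton, smul_eq_mul, ← map_mul]
      exact Ideal.mem_map_of_mem _ ((ha s).1 hs)
    exact Submodule.mem_colon_singleton.1 (hle hr))
  change algebraMap A B a ∈ Ideal.ofList (rs.map (algebraMap A B)) • (⊤ : Ideal B) at hmem
  rw [heq, IsLocalization.algebraMap_mem_map_algebraMap_iff q.primeCompl] at hmem
  obtain ⟨m, hm, hma⟩ := hmem
  exact hm ((ha m).2 hma)

/-- In a regular ring, the grade of an ideal is at least its height. -/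
theorem exists_isWeaklyRegular_of_le_height {A : Type u} [CommRing A] [IsRegularRing A]
    (J : Ideal A) (n : ℕ) (hJ : ∀ q : Ideal A, q.IsPrime → J ≤ q → (n : ℕ∞) ≤ q.height) :
    ∃ rs : List A, rs.length = n ∧ (∀ r ∈ rs, r ∈ J) ∧ IsWeaklyRegular A rs := by
  induction n with
  | zero => exact ⟨[], rfl, by simp, .nil A A⟩
  | succ n ih =>
    obtain ⟨rs, hlen, hmem, hrs⟩ := ih fun q hq hJq =>
      (by exact_mod_cast Nat.le_succ n : (n : ℕ∞) ≤ (n + 1 : ℕ)).trans (hJ q hq hJq)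
    set D := A ⧸ (Ideal.ofList rs • ⊤ : Ideal A)
    obtain ⟨x, hxJ, hx⟩ : ∃ x ∈ J, IsSMulRegular D x := by
      by_contra! h
      obtain ⟨q, hq, hJq⟩ : ∃ q ∈ associatedPrimes A D, J ≤ q :=
        (J.subset_union_prime_finite (associatedPrimes.finite A D) (f := id) 0 0
          fun _ h _ _ => h.1).1 <| by
            simp only [id, biUnion_associatedPrimes_eq_compl_regular]
            exact fun x hx => h x hx
      rw [AssociatedPrimes.mem_iff, isAssociatedPrime_iff] at hq
      obtain ⟨hqp, a, hqa⟩ := hq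
      obtain ⟨a, rfl⟩ := Submodule.Quotient.mk_surjective _ a
      have h1 := height_le_length_of_isWeaklyRegular hrs q a fun s => by
        rw [hqa, Submodule.mem_colon_singleton, Submodule.mem_bot, ← Submodule.Quotient.mk_smul,
          Submodule.Quotient.mk_eq_zero, smul_eq_mul, smul_eq_mul, Ideal.mul_top]
      have h2 := (hJ q hqp hJq).trans h1
      rw [hlen, Nat.cast_le] at h2
      omega
    refine ⟨rs ++ [x], by simp [hlen], ?_, ?_⟩
    · intro r hr
      rcases List.mem_append.1 hr with hr | hr
      · exact hmem r hr
      · rw [List.mem_singleton.1 hr]; exact hxJ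
    · rw [isWeaklyRegular_append_iff, isWeaklyRegular_singleton_iff]
      exact ⟨hrs, hx⟩

end Unmixed

end

/-! ### Canonical modules -/

section

open IsLocalRing RingTheory.Sequence CategoryTheory Abelian
open scoped Pointwise

section CanonicalModule

variable {A : Type u} [CommRing A] [IsRegularRing A]

/-- Over a regular ring `A`, `Ext^i_A(N, A)` vanishes below the height of the annihilator
of `N`. -/
theorem subsingleton_ext_of_lt_height (N : ModuleCat.{u} A) [Module.Finite A N] (n : ℕ)
    (hN : ∀ q : Ideal A, q.IsPrime → Module.annihilator A N ≤ q → (n : ℕ∞) ≤ q.height) :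
    ∀ i < n, Subsingleton (Ext N (ModuleCat.of A A) i) := by
  rcases eq_or_ne (Module.annihilator A N) ⊤ with h | h
  · intro i _
    have : Subsingleton N := Module.annihilator_eq_top_iff.1 h
    have hz : Limits.IsZero N := ModuleCat.isZero_of_subsingleton N
    refine subsingleton_of_forall_eq 0 fun x => ?_
    rw [← Ext.mk₀_id_comp x, hz.eq_of_src (𝟙 N) 0, Ext.mk₀_zero, Ext.zero_comp]
  · obtain ⟨rs, hlen, hmem, hrs⟩ := exists_isWeaklyRegular_of_le_height _ n hN
    have htop : Module.annihilator A N • (⊤ : Submodule A A) ≠ ⊤ := by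
      rwa [smul_eq_mul, Ideal.mul_top]
    have hreg : IsRegular A rs := ⟨hrs, fun htop' => htop (top_le_iff.1 (htop'.le.trans
      (Submodule.smul_mono_left (Ideal.span_le.2 hmem))))⟩
    rw [← hlen]
    exact ModuleCat.subsingleton_ext_of_exists_isRegular _ N
      (Module.support_eq_zeroLocus (R := A) (M := N)).le (ModuleCat.of A A) htop.lt_top rs hmem hreg

omit [IsRegularRing A] in
theorem length_le_height_of_isWeaklyRegular [IsNoetherianRing A] (P : Ideal A) [P.IsPrime]
    {rs : List A} (hmem : ∀ r ∈ rs, r ∈ P) (hrs : IsWeaklyRegular A rs) :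
    (rs.length : ℕ∞) ≤ P.height := by
  set B := Localization.AtPrime P
  have hreg : IsRegular B (rs.map (algebraMap A B)) :=
    hrs.isRegular_of_isLocalization_of_mem B P hmem
  have h := ringKrullDim_add_length_eq_ringKrullDim_of_isRegular _ hreg
  rw [List.length_map, IsLocalization.AtPrime.ringKrullDim_eq_height P B] at h
  have : Nontrivial (B ⧸ Ideal.ofList (rs.map (algebraMap A B))) :=
    Ideal.Quotient.nontrivial_iff.2 fun htop => hreg.2 (by rw [htop, smul_eq_mul, Ideal.mul_top])
  have h0 := ringKrullDim_nonneg_of_nontrivial (R := B ⧸ Ideal.ofList (rs.map (algebraMap A B)))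
  rw [← WithBot.coe_le_coe, ← h]
  exact le_add_of_nonneg_left h0

variable {S : Type u} [CommRing S] [IsDomain S] [Algebra A S]

omit [IsRegularRing A] [IsDomain S] in
theorem annihilator_eq_ker_algebraMap :
    Module.annihilator A S = RingHom.ker (algebraMap A S) := by
  ext a
  rw [Module.mem_annihilator, RingHom.mem_ker]
  exact ⟨fun h => by simpa [Algebra.smul_def] using h 1, fun h s => by simp [Algebra.smul_def, h]⟩

omit [IsDomain S] in
theorem subsingleton_ext_of_lt_height_ker (hsurj : Function.Surjective (algebraMap A S)) :
    ∀ i : ℕ, (i : ℕ∞) < (RingHom.ker (algebraMap A S)).height →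
      Subsingleton (Ext (ModuleCat.of A S) (ModuleCat.of A A) i) := by
  intro i hi
  have : Module.Finite A S := Module.Finite.of_surjective (Algebra.linearMap A S) hsurj
  refine subsingleton_ext_of_lt_height (ModuleCat.of A S) (i + 1) (fun q hq hle => ?_) i
    (Nat.lt_succ_self i)
  rw [show Module.annihilator A (ModuleCat.of A S) = RingHom.ker (algebraMap A S) from
    annihilator_eq_ker_algebraMap] at hle
  exact (Order.add_one_le_of_lt hi).trans (Ideal.height_mono hle)

/-- The lowest cohomology module is nonzero: otherwise the kernel of `A → S` would contain a regular
sequence longer than its height. -/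
theorem nontrivial_ext_height (hsurj : Function.Surjective (algebraMap A S)) {c : ℕ}
    (hc : (RingHom.ker (algebraMap A S)).height = c) :
    Nontrivial (Ext (ModuleCat.of A S) (ModuleCat.of A A) c) := by
  have : Module.Finite A S := Module.Finite.of_surjective (Algebra.linearMap A S) hsurj
  by_contra hsub
  rw [not_nontrivial_iff_subsingleton] at hsub
  have hP : (RingHom.ker (algebraMap A S)).IsPrime := RingHom.ker_isPrime _
  obtain ⟨rs, hlen, hmem, hreg⟩ := ModuleCat.exists_isRegular_of_exists_subsingleton_ext
    (RingHom.ker (algebraMap A S)) (c + 1) (ModuleCat.of A A) (by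
      rw [smul_eq_mul, Ideal.mul_top]; exact hP.ne_top.lt_top) (ModuleCat.of A S) (by
      rw [Module.support_eq_zeroLocus]
      exact congrArg (fun I : Ideal A => PrimeSpectrum.zeroLocus (I : Set A))
        annihilator_eq_ker_algebraMap) (fun i hi => by
      rcases Nat.lt_succ_iff_lt_or_eq.1 hi with hi | rfl
      · exact subsingleton_ext_of_lt_height_ker hsurj i (by rw [hc]; exact_mod_cast hi)
      · exact hsub)
  have := length_le_height_of_isWeaklyRegular _ hmem hreg.1
  rw [hlen, hc, Nat.cast_le] at this
  omega

/-- Multiplication by `s ≠ 0` is injective on `Ext^c_A(S, A)`, `c` the height of the kernel of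
`A → S`: the kernel is a quotient of `Ext^c_A(S ⧸ s S, A)`, which vanishes because the primes in
the support of `S ⧸ s S` have height at least `c + 1`. -/
theorem ext_eq_zero_of_mulLeft_comp_eq_zero (hsurj : Function.Surjective (algebraMap A S)) {c : ℕ}
    (hc : (RingHom.ker (algebraMap A S)).height = c) {s : S} (hs : s ≠ 0)
    (x : Ext (ModuleCat.of A S) (ModuleCat.of A A) c)
    (hx : (Ext.mk₀ (ModuleCat.ofHom (LinearMap.mulLeft A s))).comp x (zero_add c) = 0) :
    x = 0 := by
  have : Module.Finite A S := Module.Finite.of_surjective (Algebra.linearMap A S) hsurj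
  have hP : (RingHom.ker (algebraMap A S)).IsPrime := RingHom.ker_isPrime _
  let f := LinearMap.mulLeft A s
  have hexact : Function.Exact f f.range.mkQ := LinearMap.exact_map_mkQ_range f
  let C := ModuleCat.shortComplexOfCompEqZero f f.range.mkQ hexact.linearMap_comp_eq_zero
  have hC : C.ShortExact :=
    { exact := ModuleCat.shortComplex_exact C hexact
      mono_f := (ModuleCat.mono_iff_injective _).2 fun a b h => mul_left_cancel₀ hs h
      epi_g := (ModuleCat.epi_iff_surjective _).2 (Submodule.mkQ_surjective _) }
  obtain ⟨x₃, rfl⟩ := Ext.contravariant_sequence_exact₂ hC (ModuleCat.of A A) x hx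
  obtain ⟨a, rfl⟩ := hsurj s
  have : Module.Finite A C.X₃ := inferInstanceAs (Module.Finite A (S ⧸ f.range))
  have hsub := subsingleton_ext_of_lt_height C.X₃ (c + 1) (fun q hq hle => by
    have hle' : Module.annihilator A (S ⧸ f.range) ≤ q := hle
    have h1 : RingHom.ker (algebraMap A S) ≤ q := by
      rw [← annihilator_eq_ker_algebraMap]
      exact (LinearMap.annihilator_le_of_surjective f.range.mkQ
        (Submodule.mkQ_surjective _)).trans hle'
    have h2 : a ∈ q := hle' <| Module.mem_annihilator.2 fun y => by
      obtain ⟨y, rfl⟩ := Submodule.mkQ_surjective _ y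
      rw [← map_smul, Submodule.mkQ_apply, Submodule.Quotient.mk_eq_zero]
      exact ⟨y, (Algebra.smul_def a y).symm⟩
    have hlt : RingHom.ker (algebraMap A S) < q :=
      lt_of_le_of_ne h1 fun h => hs (RingHom.mem_ker.1 (h ▸ h2))
    have := Ideal.height_add_one_le_of_lt_of_isPrime hlt
    rw [hc] at this
    exact_mod_cast this) c (Nat.lt_succ_self c)
  rw [Subsingleton.elim x₃ 0, Ext.comp_zero]

end CanonicalModule

section

variable {S : Type u} [CommRing S] [IsDomain S] {ω : Type u} [AddCommGroup ω] [Module S ω]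

theorem IsCanonicalModule.nontrivial (h : IsCanonicalModule S ω) : Nontrivial ω := by
  obtain ⟨A, _, _, _, c, e, hsurj, hc, -⟩ := h
  have := nontrivial_ext_height hsurj hc
  exact e.toEquiv.nontrivial

theorem IsCanonicalModule.isTorsionFree (h : IsCanonicalModule S ω) :
    Module.IsTorsionFree S ω := by
  obtain ⟨A, _, _, _, c, e, hsurj, hc, he⟩ := h
  rw [Module.isTorsionFree_iff_smul_eq_zero]
  intro s x hsx
  by_contra! hne
  refine hne.2 (e.map_eq_zero_iff.1 (ext_eq_zero_of_mulLeft_comp_eq_zero hsurj hc hne.1 _ ?_))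
  rw [← he, hsx, map_zero]

omit [IsDomain S] in
/-- The action of `S` on `Ext^c_A(S, N)` through the first argument extends that of `A`. -/
theorem mk₀_mulLeft_algebraMap_comp {A : Type u} [CommRing A] [Algebra A S] {N : ModuleCat.{u} A}
    {c : ℕ} (a : A) (x : Ext (ModuleCat.of A S) N c) :
    (Ext.mk₀ (ModuleCat.ofHom (LinearMap.mulLeft A (algebraMap A S a)))).comp x (zero_add c) =
      a • x := by
  have : ModuleCat.ofHom (LinearMap.mulLeft A (algebraMap A S a)) = a • 𝟙 (ModuleCat.of A S) := by
    ext y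
    exact (Algebra.smul_def a y).symm
  rw [this, Ext.mk₀_smul, Ext.smul_comp, Ext.mk₀_id_comp]

theorem IsCanonicalModule.finite (h : IsCanonicalModule S ω) : Module.Finite S ω := by
  obtain ⟨A, _, _, _, c, e, hsurj, hc, he⟩ := h
  have : Module.Finite A S := Module.Finite.of_surjective (Algebra.linearMap A S) hsurj
  let modA : Module A ω := Module.compHom ω (algebraMap A S)
  have : IsScalarTower A S ω := IsScalarTower.of_algebraMap_smul fun _ _ => rfl
  let e' : ω ≃ₗ[A] Ext (ModuleCat.of A S) (ModuleCat.of A A) c :=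
    { e with
      map_smul' := fun a x => (he (algebraMap A S a) x).trans (mk₀_mulLeft_algebraMap_comp a _) }
  have : Module.Finite A ω := Module.Finite.equiv e'.symm
  exact Module.Finite.of_restrictScalars_finite A S ω

/-- A domain that is a quotient of a regular ring has a canonical module. -/
theorem exists_isCanonicalModule_of_surjective {A : Type u} [CommRing A] [IsRegularRing A]
    (φ : A →+* S) (hφ : Function.Surjective φ) :
    ∃ (ω : Type u) (_ : AddCommGroup ω) (_ : Module S ω), IsCanonicalModule S ω := by
  let : Algebra A S := φ.toAlgebra
  have hP : (RingHom.ker (algebraMap A S)).IsPrime := RingHom.ker_isPrime _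
  obtain ⟨c, hc⟩ := ENat.ne_top_iff_exists.1 (Ideal.height_ne_top hP.ne_top)
  let E := Ext (ModuleCat.of A S) (ModuleCat.of A A) c
  let : Module S E :=
    { smul := fun s x => (Ext.mk₀ (ModuleCat.ofHom (LinearMap.mulLeft A s))).comp x (zero_add c)
      one_smul := fun x => by
        have : ModuleCat.ofHom (LinearMap.mulLeft A (1 : S)) = 𝟙 (ModuleCat.of A S) := by
          ext y; exact one_mul y
        change (Ext.mk₀ (ModuleCat.ofHom (LinearMap.mulLeft A (1 : S)))).comp x (zero_add c) = x
        rw [this, Ext.mk₀_id_comp]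
      mul_smul := fun s t x => by
        have : ModuleCat.ofHom (LinearMap.mulLeft A (s * t)) =
            ModuleCat.ofHom (LinearMap.mulLeft A s) ≫ ModuleCat.ofHom (LinearMap.mulLeft A t) := by
          ext y; exact (congrArg (· * y) (mul_comm s t)).trans (mul_assoc t s y)
        change (Ext.mk₀ (ModuleCat.ofHom (LinearMap.mulLeft A (s * t)))).comp x (zero_add c) =
          (Ext.mk₀ (ModuleCat.ofHom (LinearMap.mulLeft A s))).comp
            ((Ext.mk₀ (ModuleCat.ofHom (LinearMap.mulLeft A t))).comp x (zero_add c)) (zero_add c)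
        rw [this, Ext.mk₀_comp_mk₀_assoc]
      smul_zero := fun s => Ext.comp_zero _ _ _ _ _
      smul_add := fun s x y => Ext.comp_add _ _ _ _
      add_smul := fun s t x => by
        have : ModuleCat.ofHom (LinearMap.mulLeft A (s + t)) =
            ModuleCat.ofHom (LinearMap.mulLeft A s) + ModuleCat.ofHom (LinearMap.mulLeft A t) := by
          ext y; exact add_mul s t y
        change (Ext.mk₀ (ModuleCat.ofHom (LinearMap.mulLeft A (s + t)))).comp x (zero_add c) =
          (Ext.mk₀ (ModuleCat.ofHom (LinearMap.mulLeft A s))).comp x (zero_add c) +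
          (Ext.mk₀ (ModuleCat.ofHom (LinearMap.mulLeft A t))).comp x (zero_add c)
        rw [this, Ext.mk₀_add, Ext.add_comp]
      zero_smul := fun x => by
        have : ModuleCat.ofHom (LinearMap.mulLeft A (0 : S)) =
            (0 : ModuleCat.of A S ⟶ ModuleCat.of A S) := by
          ext y; exact zero_mul y
        change (Ext.mk₀ (ModuleCat.ofHom (LinearMap.mulLeft A (0 : S)))).comp x (zero_add c) = 0
        rw [this, Ext.mk₀_zero, Ext.zero_comp] }
  exact ⟨E, inferInstance, inferInstance, A, inferInstance, inferInstance, inferInstance, c,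
    AddEquiv.refl E, hφ, hc.symm, fun _ _ => rfl⟩

end

end

/-! ### Successive approximation and complete rings -/

section

open IsLocalRing RingTheory.Sequence

section Approximation

variable {A : Type*} [CommRing A]

/-- Successive approximation: if, up to elements deeper in a complete separated filtration `K`,
every element of `J` is a combination of finitely many `g i ∈ J` whose coefficients tend to zero,
then the `g i` generate `J`. -/
theorem mem_span_range_of_approximation {K : ℕ → Ideal A} (hK : Antitone K)
    (hlim : ∀ f : ℕ → A, (∀ n, f (n + 1) - f n ∈ K n) → ∃ l, ∀ n, l - f n ∈ K n)
    (hsep : ∀ x, (∀ n, x ∈ K n) → x = 0) {ι : Type*} [Fintype ι] {g : ι → A} {J : Ideal A}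
    (hg : ∀ i, g i ∈ J) (d : ℕ)
    (step : ∀ n, ∀ j ∈ J, j ∈ K n →
      ∃ a : ι → A, (∀ i, a i ∈ K (n - d)) ∧ j - ∑ i, a i * g i ∈ K (n + 1))
    {j : A} (hj : j ∈ J) (hj0 : j ∈ K 0) : j ∈ Ideal.span (Set.range g) := by
  choose! a ha hstep using step
  -- the remainders
  let r : ℕ → A := fun n => Nat.rec j (fun n x => x - ∑ i, a n x i * g i) n
  have hr0 : r 0 = j := rfl
  have hrs (n : ℕ) : r (n + 1) = r n - ∑ i, a n (r n) i * g i := rfl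
  have hr (n : ℕ) : r n ∈ J ∧ r n ∈ K n := by
    induction n with
    | zero => exact ⟨hj, hj0⟩
    | succ n ih =>
      rw [hrs]
      exact ⟨sub_mem ih.1 (Ideal.sum_mem _ fun i _ => Ideal.mul_mem_left _ _ (hg i)),
        hstep n _ ih.1 ih.2⟩
  let s : ι → ℕ → A := fun i n => ∑ k ∈ Finset.range n, a k (r k) i
  have hs (n : ℕ) : j = r n + ∑ i, s i n * g i := by
    induction n with
    | zero => simp [s, hr0]
    | succ n ih =>
      simp only [s, Finset.sum_range_succ, add_mul, Finset.sum_add_distrib, hrs]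
      rw [ih]
      simp only [s]
      ring
  have hl (i : ι) : ∃ l, ∀ n, l - s i (n + d) ∈ K n := by
    refine hlim (fun n => s i (n + d)) fun n => ?_
    have : s i (n + 1 + d) - s i (n + d) = a (n + d) (r (n + d)) i := by
      simp only [s, add_right_comm n 1 d, Finset.sum_range_succ]
      ring
    rw [this]
    simpa using ha (n + d) _ (hr (n + d)).1 (hr (n + d)).2 i
  choose l hl using hl
  have : j = ∑ i, l i * g i := by
    rw [← sub_eq_zero]
    refine hsep _ fun n => ?_
    have : j - ∑ i, l i * g i = r (n + d) - ∑ i, (l i - s i (n + d)) * g i := by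
      conv_lhs => rw [hs (n + d)]
      simp only [sub_mul, Finset.sum_sub_distrib]
      ring
    rw [this]
    exact sub_mem (hK (Nat.le_add_right n d) (hr _).2)
      (Ideal.sum_mem _ fun i _ => Ideal.mul_mem_right _ _ (hl i n))
  rw [this]
  exact Ideal.sum_mem _ fun i _ => Ideal.mul_mem_left _ _ (Ideal.subset_span ⟨i, rfl⟩)

open MvPolynomial in
/-- A ring `A` that is complete and separated for the powers of a finitely generated ideal `I`
with `A ⧸ I` Noetherian is Noetherian. The leading forms of an ideal `J`, i.e. the forms `F` such
that `F y ∈ J` up to higher order, generate a finitely generated ideal of `(A ⧸ I)[Y]`, and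
elements of `J` realizing such generators generate `J` by successive approximation. -/
theorem isNoetherianRing_of_complete {m : ℕ} (y : Fin m → A) (I : Ideal A)
    (hI : I = Ideal.span (Set.range y)) [IsNoetherianRing (A ⧸ I)]
    (hlim : ∀ f : ℕ → A, (∀ n, f (n + 1) - f n ∈ I ^ n) → ∃ l, ∀ n, l - f n ∈ I ^ n)
    (hsep : ∀ x, (∀ n, x ∈ I ^ n) → x = 0) : IsNoetherianRing A := by
  classical
  refine (isNoetherianRing_iff_ideal_fg A).2 fun J => ?_
  let G : Set (MvPolynomial (Fin m) A) :=
    {F | ∃ n, F.IsHomogeneous n ∧ ∃ j ∈ J, eval y F - j ∈ I ^ (n + 1)}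
  let φ : MvPolynomial (Fin m) A →+* MvPolynomial (Fin m) (A ⧸ I) :=
    MvPolynomial.map (Ideal.Quotient.mk I)
  have hφ : Function.Surjective φ := map_surjective _ Ideal.Quotient.mk_surjective
  obtain ⟨t, htG, ht⟩ := (Submodule.fg_span_iff_fg_span_finset_subset (φ '' G)).1
    (IsNoetherian.noetherian (Ideal.span (φ '' G)))
  have hF (i : t) : ∃ F ∈ G, φ F = i := htG i.2
  choose F hFG hFi using hF
  choose n hFn g hgJ hg using hFG
  have heval {k : ℕ} {H : MvPolynomial (Fin m) A} (hH : H.IsHomogeneous k) : eval y H ∈ I ^ k := by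
    rw [hI, Ideal.mem_span_pow_iff_exists_isHomogeneous]
    exact ⟨H, hH, rfl⟩
  have hker {k : ℕ} {H : MvPolynomial (Fin m) A} (hH : H.IsHomogeneous k) (h0 : φ H = 0) :
      eval y H ∈ I ^ (k + 1) := by
    rw [eval_eq]
    refine Ideal.sum_mem _ fun d hd => ?_
    rw [pow_succ']
    refine Ideal.mul_mem_mul ?_ ?_
    · have := congrArg (coeff d) h0
      rwa [coeff_map, coeff_zero, Ideal.Quotient.eq_zero_iff_mem] at this
    · have hdk : d.degree = k := by
        by_contra h
        exact mem_support_iff.1 hd (hH.coeff_eq_zero h)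
      have := heval (isHomogeneous_monomial (1 : A) hdk)
      rwa [eval_monomial, one_mul, Finsupp.prod] at this
  have hcomp (k l : ℕ) (H H' : MvPolynomial (Fin m) A) (hH' : H'.IsHomogeneous l) :
      ∃ a : MvPolynomial (Fin m) A, homogeneousComponent k (H * H') = a * H' ∧
        (l ≤ k → a.IsHomogeneous (k - l)) ∧ (¬ l ≤ k → a = 0) := by
    refine ⟨if l ≤ k then homogeneousComponent (k - l) H else 0, ?_, fun h => ?_, fun h => ?_⟩
    · conv_lhs => rw [← sum_homogeneousComponent H, Finset.sum_mul, map_sum]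
      have h1 (i : ℕ) : homogeneousComponent k (homogeneousComponent i H * H') =
          if k = i + l then homogeneousComponent i H * H' else 0 :=
        homogeneousComponent_of_mem ((homogeneousComponent_isHomogeneous i H).mul hH')
      simp only [h1]
      split_ifs with h
      · have h2 (i : ℕ) : k = i + l ↔ i = k - l := by omega
        simp only [h2, Finset.sum_ite_eq', Finset.mem_range]
        split_ifs with h3
        · rfl
        · rw [homogeneousComponent_eq_zero _ _ (by omega), zero_mul]
      · rw [zero_mul]
        exact Finset.sum_eq_zero fun i _ => if_neg (by omega)
    · rw [if_pos h]; exact homogeneousComponent_isHomogeneous _ _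
    · rw [if_neg h]
  refine ⟨Finset.univ.image g, ?_⟩
  rw [Finset.coe_image, Finset.coe_univ, Set.image_univ]
  refine le_antisymm (Ideal.span_le.2 (Set.range_subset_iff.2 hgJ)) fun j hj => ?_
  refine mem_span_range_of_approximation (K := fun n => I ^ n)
    (fun a b hab => Ideal.pow_le_pow_right hab) hlim hsep hgJ (Finset.univ.sup n) ?_ hj (by simp)
  intro k j hjJ hjk
  rw [hI, Ideal.mem_span_pow_iff_exists_isHomogeneous] at hjk
  obtain ⟨H, hH, rfl⟩ := hjk
  have hmem : φ H ∈ Ideal.span (t : Set (MvPolynomial (Fin m) (A ⧸ I))) := by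
    rw [Ideal.span, ← ht]
    exact Submodule.subset_span ⟨H, ⟨k, hH, _, hjJ, by simp⟩, rfl⟩
  obtain ⟨c, hc⟩ : ∃ c : t → MvPolynomial (Fin m) (A ⧸ I), ∑ i, c i * i = φ H := by
    obtain ⟨c, -, hc⟩ := Submodule.mem_span_finset.1 hmem
    refine ⟨fun i => c i, ?_⟩
    rw [← hc]
    exact Finset.sum_coe_sort t fun b => c b * b
  choose C hC using fun i => hφ (c i)
  choose a ha ha1 ha0 using fun i => hcomp k (n i) (C i) (F i) (hFn i)
  have hE : φ (H - ∑ i, a i * F i) = 0 := by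
    have h1 : H - ∑ i, a i * F i = homogeneousComponent k (H - ∑ i, C i * F i) := by
      simp only [map_sub, map_sum, ha, homogeneousComponent_eq_self hH]
    have h2 : φ (H - ∑ i, C i * F i) = 0 := by
      simp only [map_sub, map_sum, map_mul, hC, hFi, hc, sub_self]
    ext d
    have h3 := congrArg (coeff d) h2
    rw [coeff_map, coeff_zero] at h3
    rw [h1, coeff_map, coeff_homogeneousComponent, coeff_zero]
    split_ifs
    · exact h3
    · exact map_zero _
  have hEhom : (H - ∑ i, a i * F i).IsHomogeneous k := by
    refine hH.sub (IsHomogeneous.sum _ _ _ fun i _ => ?_)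
    rw [← ha]
    exact homogeneousComponent_isHomogeneous _ _
  refine ⟨fun i => eval y (a i), fun i => ?_, ?_⟩
  · by_cases h : n i ≤ k
    · exact Ideal.pow_le_pow_right (by
        have := Finset.le_sup (f := n) (Finset.mem_univ i); omega) (heval (ha1 i h))
    · simp [ha0 i h]
  · have h1 := hker hEhom hE
    have h2 : eval y H - ∑ i, eval y (a i) * g i = eval y (H - ∑ i, a i * F i) +
        ∑ i, eval y (a i) * (eval y (F i) - g i) := by
      simp only [map_sub, map_sum, map_mul, mul_sub, Finset.sum_sub_distrib]
      ring
    rw [h2]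
    refine add_mem h1 (Ideal.sum_mem _ fun i _ => ?_)
    by_cases h : n i ≤ k
    · have := Ideal.mul_mem_mul (heval (ha1 i h)) (hg i)
      rwa [← pow_add, show k - n i + (n i + 1) = k + 1 by omega] at this
    · simp [ha0 i h]

end Approximation

end

/-! ### Regularity from a dual basis for Frobenius -/

section

open IsLocalRing RingTheory.Sequence

section Lech

/-- A finite family `f` of elements of a ring is Lech independent if the coefficients of every
relation `∑ b i * f i = 0` lie in the ideal generated by the `f i`. -/
def LechIndependent {B : Type*} [CommRing B] {ι : Type*} [Fintype ι] (f : ι → B) : Prop :=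
  ∀ b : ι → B, ∑ i, b i * f i = 0 → ∀ i, b i ∈ Ideal.span (Set.range f)

variable {B : Type*} [CommRing B] {ι : Type*} [Fintype ι] [DecidableEq ι]

/-- Lech's lemma: Lech independence is inherited on replacing a member by one of its divisors. -/
theorem LechIndependent.update {f : ι → B} (hf : LechIndependent f) {t : ι} {g h : B}
    (hgh : f t = g * h) : LechIndependent (Function.update f t g) := by
  set f' := Function.update f t g with hf'
  have hle : Ideal.span (Set.range f) ≤ Ideal.span (Set.range f') := by
    refine Ideal.span_le.2 (Set.range_subset_iff.2 fun i => ?_)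
    rcases eq_or_ne i t with rfl | hi
    · rw [hgh]
      exact Ideal.mul_mem_right _ _ (Ideal.subset_span ⟨i, by simp [hf']⟩)
    · exact Ideal.subset_span ⟨i, by simp [hf', hi]⟩
  have hsum (b : ι → B) : ∑ i, b i * f' i = b t * g + ∑ i ∈ Finset.univ.erase t, b i * f i := by
    rw [← Finset.add_sum_erase _ _ (Finset.mem_univ t)]
    congr 1
    · simp [hf']
    · exact Finset.sum_congr rfl fun i hi => by simp [hf', Finset.ne_of_mem_erase hi]
  have hsum' (b : ι → B) : ∑ i, b i * f i = b t * f t + ∑ i ∈ Finset.univ.erase t, b i * f i :=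
    (Finset.add_sum_erase _ _ (Finset.mem_univ t)).symm
  intro b hb i
  rw [hsum] at hb
  -- multiplying the relation by `h` yields a relation between the `f i`
  have h1 : ∀ j, (if j = t then b t else h * b j) ∈ Ideal.span (Set.range f) := by
    refine hf _ ?_
    rw [hsum', if_pos rfl, hgh]
    have : ∑ i ∈ Finset.univ.erase t, (if i = t then b t else h * b i) * f i =
        h * ∑ i ∈ Finset.univ.erase t, b i * f i := by
      rw [Finset.mul_sum]
      exact Finset.sum_congr rfl fun i hi => by
        rw [if_neg (Finset.ne_of_mem_erase hi), mul_assoc]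
    rw [this]
    linear_combination h * hb
  rcases eq_or_ne i t with rfl | hi
  · simpa using hle (h1 i)
  · have h2 := h1 i
    rw [if_neg hi, Ideal.mem_span_range_iff_exists_fun] at h2
    obtain ⟨c, hc⟩ := h2
    rw [hsum'] at hc
    -- multiplying `h * b i = ∑ c j * f j` by `g` yields another one
    have h3 : ∀ j, (if j = t then b i - c t * g else - (g * c j)) ∈ Ideal.span (Set.range f) := by
      refine hf _ ?_
      rw [hsum', if_pos rfl]
      have : ∑ j ∈ Finset.univ.erase t, (if j = t then b i - c t * g else - (g * c j)) * f j =
          - (g * ∑ j ∈ Finset.univ.erase t, c j * f j) := by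
        rw [Finset.mul_sum, ← Finset.sum_neg_distrib]
        exact Finset.sum_congr rfl fun j hj => by
          rw [if_neg (Finset.ne_of_mem_erase hj)]; ring
      rw [this]
      linear_combination (-g) * hc + b i * hgh
    have h4 := hle (h3 t)
    rw [if_pos rfl] at h4
    have h5 : c t * g ∈ Ideal.span (Set.range f') :=
      Ideal.mul_mem_left _ _ (Ideal.subset_span ⟨t, by simp [hf']⟩)
    simpa using add_mem h4 h5

/-- If the powers `x i ^ q` are Lech independent, any of them may be replaced by the `x i`. -/
theorem LechIndependent.of_pow {x : ι → B} {q : ℕ} (hq : q ≠ 0)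
    (hx : LechIndependent fun i => x i ^ q) (U : Finset ι) :
    LechIndependent fun i => if i ∈ U then x i else x i ^ q := by
  induction U using Finset.induction_on with
  | empty => simpa using hx
  | insert t U ht ih =>
    have := ih.update (t := t) (g := x t) (h := x t ^ (q - 1))
      (by rw [if_neg ht, ← pow_succ', Nat.sub_add_cancel (Nat.pos_of_ne_zero hq)])
    convert this using 1
    ext i
    rcases eq_or_ne i t with rfl | hi
    · simp
    · simp [hi]

end Lech

section LechRegular

variable {B : Type*} [CommRing B] [IsLocalRing B] [IsNoetherianRing B]

/-- If arbitrarily high powers of `x i ∈ 𝔪` are Lech independent, then the `x i` form a weakly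
regular sequence. -/
theorem isWeaklyRegular_ofFn_of_lechIndependent {r : ℕ} {x : Fin r → B}
    (hx : ∀ i, x i ∈ maximalIdeal B)
    (hind : ∀ N, ∃ q, N < q ∧ LechIndependent fun i => x i ^ q) :
    IsWeaklyRegular B (List.ofFn x) := by
  classical
  have key (k : Fin r) (a : B) (ha : a * x k ∈ Ideal.span (x '' {i | i < k})) :
      a ∈ Ideal.span (x '' {i | i < k}) := by
    set J := Ideal.span (x '' {i | i < k}) with hJ
    have hJtop : J ≠ ⊤ := by
      refine ne_top_of_le_ne_top (maximalIdeal.isMaximal B).ne_top (Ideal.span_le.2 ?_)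
      rintro _ ⟨i, -, rfl⟩
      exact hx i
    rw [← Ideal.Quotient.eq_zero_iff_mem]
    have hmem : Ideal.Quotient.mk J a ∈
        (⨅ n : ℕ, maximalIdeal B ^ n • ⊤ : Submodule B (B ⧸ J)) := by
      rw [Submodule.mem_iInf]
      intro N
      obtain ⟨q, hNq, hq⟩ := hind N
      have hU := hq.of_pow (by omega) (Finset.univ.filter (· < k))
      simp only [Finset.mem_filter, Finset.mem_univ, true_and] at hU
      have hq0 : a * x k ^ q ∈ J := by
        rw [← Nat.sub_add_cancel (show 1 ≤ q by omega), pow_succ', ← mul_assoc]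
        exact Ideal.mul_mem_right _ _ ha
      have hrel : ∃ b : Fin r → B, b k = a ∧
          ∑ i, b i * (if i < k then x i else x i ^ q) = 0 := by
        rw [hJ, Submodule.mem_span_image_iff_exists_fun] at hq0
        obtain ⟨t, ht, c, hc⟩ := hq0
        refine ⟨fun i => if h : i ∈ t then - c ⟨i, h⟩ else if i = k then a else 0, ?_, ?_⟩
        · have : k ∉ t := fun h => lt_irrefl k (ht h)
          simp [this]
        · have h1 (i : Fin r) : (if h : i ∈ t then - c ⟨i, h⟩ else if i = k then a else 0) *
              (if i < k then x i else x i ^ q) =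
              - (if h : i ∈ t then c ⟨i, h⟩ * x i else 0) + if i = k then a * x i ^ q else 0 := by
            by_cases h : i ∈ t
            · have h2 : i < k := ht h
              simp [h, h2, h2.ne]
            · by_cases h2 : i = k
              · subst h2
                simp [h]
              · simp [h, h2]
          simp only [h1, Finset.sum_add_distrib, Finset.sum_neg_distrib, Finset.sum_ite_eq',
            Finset.mem_univ, if_true]
          rw [← hc, neg_add_eq_zero, ← Finset.sum_subset t.subset_univ]
          · rw [← Finset.sum_coe_sort t]
            exact Finset.sum_congr rfl fun i _ => by simp
          · intro i _ hi
            simp [hi]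
      obtain ⟨b, rfl, hb⟩ := hrel
      have h1 := hU b hb k
      have h2 : Ideal.span (Set.range fun i => if i < k then x i else x i ^ q) ≤
          J ⊔ maximalIdeal B ^ N := by
        refine Ideal.span_le.2 (Set.range_subset_iff.2 fun i => ?_)
        by_cases h : i < k
        · rw [if_pos h]
          exact Ideal.mem_sup_left (Ideal.subset_span ⟨i, h, rfl⟩)
        · rw [if_neg h]
          exact Ideal.mem_sup_right (Ideal.pow_le_pow_right hNq.le (Ideal.pow_mem_pow (hx i) q))
      obtain ⟨u, hu, v, hv, huv⟩ := Submodule.mem_sup.1 (h2 h1)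
      rw [← huv, map_add, Ideal.Quotient.eq_zero_iff_mem.2 hu, zero_add]
      have : Ideal.Quotient.mk J v = v • (1 : B ⧸ J) := by
        rw [Algebra.smul_def, mul_one]; rfl
      rw [this]
      exact Submodule.smul_mem_smul hv trivial
    rw [Ideal.iInf_pow_smul_eq_bot_of_isLocalRing _ (maximalIdeal.isMaximal B).ne_top] at hmem
    exact hmem
  rw [isWeaklyRegular_iff]
  intro i hi
  rw [List.length_ofFn] at hi
  have hset : Ideal.ofList ((List.ofFn x).take i) = Ideal.span (x '' {j | j < ⟨i, hi⟩}) := by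
    rw [Ideal.ofList]
    congr 1
    ext z
    simp only [Set.mem_ofPred_eq, List.mem_take_iff_getElem, Set.mem_image, List.length_ofFn,
      List.getElem_ofFn]
    constructor
    · rintro ⟨j, hj, rfl⟩
      exact ⟨⟨j, by omega⟩, by simp only [Fin.mk_lt_mk]; omega, rfl⟩
    · rintro ⟨j, hj, rfl⟩
      exact ⟨j, by have := Fin.lt_def.1 hj; simp at this; omega, rfl⟩
  rw [hset]
  simp only [List.getElem_ofFn]
  rw [isSMulRegular_iff_right_eq_zero_of_smul]
  intro m hm
  obtain ⟨a, rfl⟩ := Submodule.Quotient.mk_surjective _ m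
  rw [← Submodule.Quotient.mk_smul, Submodule.Quotient.mk_eq_zero] at hm
  rw [Submodule.Quotient.mk_eq_zero]
  rw [smul_eq_mul, Ideal.mul_top] at hm ⊢
  exact key _ a (by rwa [mul_comm])

end LechRegular

section Kunz

/-- A dual basis of the `A`-module `F_* A`: every `f` is a combination of the `T i`, with
coefficients the `p`-th powers of coordinates that are `A`-linear as maps `F_* A → A`. Its existence
means that `F_* A` is finite projective over `A`. -/
structure FrobeniusDualBasis (p : ℕ) (A : Type*) [CommRing A] (ι : Type*) [Fintype ι] where
  /-- The generators. -/
  T : ι → A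
  /-- The coordinates, which are linear over the `p`-th power map. -/
  coord : ι → A →+ A
  coord_pow_mul : ∀ i g f, coord i (g ^ p * f) = g * coord i f
  sum_coord_pow_mul : ∀ f, ∑ i, coord i f ^ p * T i = f

variable {p : ℕ} [Fact p.Prime] {A : Type*} [CommRing A] {κ : Type*} [Fintype κ]

theorem pow_mem_span_range_pow {B : Type*} [CommRing B] [CharP B p] {ι : Type*} [Fintype ι]
    {x : ι → B} {a : B} (ha : a ∈ Ideal.span (Set.range x)) :
    a ^ p ∈ Ideal.span (Set.range fun i => x i ^ p) := by
  obtain ⟨c, rfl⟩ := Ideal.mem_span_range_iff_exists_fun.1 ha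
  rw [sum_pow_char]
  refine Ideal.sum_mem _ fun i _ => ?_
  rw [mul_pow]
  exact Ideal.mul_mem_left _ _ (Ideal.subset_span ⟨i, rfl⟩)

/-- The part of Kunz's theorem that uses flatness of Frobenius: relations between `p ^ e`-th
powers of a minimal generating family of the maximal ideal of a localization have coefficients in
the ideal of these powers. -/
theorem FrobeniusDualBasis.lechIndependent_pow (D : FrobeniusDualBasis p A κ) (Q : Ideal A)
    [Q.IsPrime] [CharP (Localization.AtPrime Q) p] {r : ℕ}
    (hr : r = (maximalIdeal (Localization.AtPrime Q)).spanFinrank) {x : Fin r → A}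
    (hx : Ideal.span (Set.range fun i => algebraMap A (Localization.AtPrime Q) (x i)) =
      maximalIdeal (Localization.AtPrime Q)) (e : ℕ) :
    LechIndependent fun i => algebraMap A (Localization.AtPrime Q) (x i) ^ p ^ e := by
  classical
  set B := Localization.AtPrime Q
  have hA (e : ℕ) : ∀ b : Fin r → A, ∑ i, b i * x i ^ p ^ e = 0 → ∀ i, algebraMap A B (b i) ∈
      Ideal.span (Set.range fun i => algebraMap A B (x i) ^ p ^ e) := by
    induction e with
    | zero =>
      intro b hb i
      simp only [pow_zero, pow_one] at hb ⊢
      rw [hx, mem_maximalIdeal, mem_nonunits_iff]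
      intro hu
      -- a unit coefficient would make the generating family redundant
      have hle : maximalIdeal B ≤ Ideal.span ((fun i => algebraMap A B (x i)) '' {i}ᶜ) := by
        rw [← hx]
        refine Ideal.span_le.2 (Set.range_subset_iff.2 fun j => ?_)
        rcases eq_or_ne j i with rfl | hj
        · rw [SetLike.mem_coe, ← Ideal.unit_mul_mem_iff_mem _ hu, ← map_mul]
          have : b j * x j = - ∑ k ∈ Finset.univ.erase j, b k * x k := by
            rw [eq_neg_iff_add_eq_zero,
              Finset.add_sum_erase _ (fun k => b k * x k) (Finset.mem_univ j), hb]
          rw [this, map_neg, map_sum]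
          refine neg_mem (Ideal.sum_mem _ fun k hk => ?_)
          rw [map_mul]
          exact Ideal.mul_mem_left _ _
            (Ideal.subset_span ⟨k, by simpa using Finset.ne_of_mem_erase hk, rfl⟩)
        · exact Ideal.subset_span ⟨j, by simpa using hj, rfl⟩
      have heq : maximalIdeal B = Ideal.span ((fun i => algebraMap A B (x i)) '' {i}ᶜ) := by
        refine le_antisymm hle ?_
        rw [← hx]
        exact Ideal.span_mono (Set.image_subset_range _ _)
      have h1 : r ≤ ((fun i => algebraMap A B (x i)) '' {i}ᶜ).ncard := by
        conv_lhs => rw [hr, heq]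
        exact Submodule.spanFinrank_span_le_ncard_of_finite (Set.toFinite _)
      have h2 : ((fun i => algebraMap A B (x i)) '' {i}ᶜ).ncard ≤ ({i}ᶜ : Set (Fin r)).ncard :=
        Set.ncard_image_le (Set.toFinite _)
      have h3 : ({i}ᶜ : Set (Fin r)).ncard = r - 1 := by
        rw [Set.ncard_compl, Set.ncard_singleton, Nat.card_eq_fintype_card, Fintype.card_fin]
      have := i.2
      omega
    | succ e ih =>
      intro b hb i
      rw [← D.sum_coord_pow_mul (b i), map_sum]
      refine Ideal.sum_mem _ fun a _ => ?_
      rw [map_mul, map_pow]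
      refine Ideal.mul_mem_right _ _ ?_
      have h1 : ∑ i, D.coord a (b i) * x i ^ p ^ e = 0 := by
        have := congrArg (D.coord a) hb
        rw [map_sum, map_zero] at this
        rw [← this]
        refine Finset.sum_congr rfl fun i _ => ?_
        rw [pow_succ, pow_mul, mul_comm (b i), D.coord_pow_mul, mul_comm]
      have h2 := pow_mem_span_range_pow (p := p) (ih _ h1 i)
      simpa only [← pow_mul, ← pow_succ] using h2
  intro b hb i
  obtain ⟨s, hs⟩ := IsLocalization.exist_integer_multiples_of_finite Q.primeCompl b
  choose a ha using hs
  have h1 : algebraMap A B (∑ i, a i * x i ^ p ^ e) = 0 := by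
    rw [map_sum]
    have : ∀ i, algebraMap A B (a i * x i ^ p ^ e) =
        algebraMap A B s * (b i * algebraMap A B (x i) ^ p ^ e) := by
      intro i
      rw [map_mul, ha, map_pow, Algebra.smul_def, mul_assoc]
    simp only [this, ← Finset.mul_sum]
    exact (congrArg _ hb).trans (mul_zero _)
  obtain ⟨t, ht⟩ := (IsLocalization.map_eq_zero_iff Q.primeCompl B _).1 h1
  have h2 := hA e (fun i => t * a i) (by simpa only [mul_assoc, ← Finset.mul_sum] using ht) i
  rw [map_mul, ha, Algebra.smul_def] at h2
  rwa [Ideal.unit_mul_mem_iff_mem _ (IsLocalization.map_units B t),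
    Ideal.unit_mul_mem_iff_mem _ (IsLocalization.map_units B s)] at h2

/-- Kunz: a Noetherian ring of characteristic `p` for which `F_* A` is finite
projective is regular. -/
theorem FrobeniusDualBasis.isRegularRing [CharP A p] [IsNoetherianRing A]
    (D : FrobeniusDualBasis p A κ) :
    IsRegularRing A := by
  classical
  rw [isRegularRing_iff]
  intro Q _
  set B := Localization.AtPrime Q
  have : CharP B p := by
    rcases CharP.exists B with ⟨q, hq⟩
    have : (p : B) = 0 := by
      rw [← map_natCast (algebraMap A B), CharP.cast_eq_zero, map_zero]
    exact (CharP.charP_iff_prime_eq_zero Fact.out).2 this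
  obtain ⟨s, hcard, hs⟩ := Submodule.FG.exists_span_finset_card_eq_spanFinrank
    (IsNoetherian.noetherian (maximalIdeal B))
  obtain ⟨u, hu⟩ := IsLocalization.exist_integer_multiples_of_finite Q.primeCompl
    (fun i : Fin s.card => (s.equivFin.symm i : B))
  choose x hx using hu
  have hxspan : Ideal.span (Set.range fun i => algebraMap A B (x i)) = maximalIdeal B := by
    rw [← hs]
    refine le_antisymm (Ideal.span_le.2 (Set.range_subset_iff.2 fun i => ?_))
      (Ideal.span_le.2 fun z hz => ?_)
    · rw [hx, Algebra.smul_def]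
      exact Ideal.mul_mem_left _ _ (Ideal.subset_span (s.equivFin.symm i).2)
    · rw [SetLike.mem_coe, ← Ideal.unit_mul_mem_iff_mem _ (IsLocalization.map_units B u)]
      refine Ideal.subset_span ⟨s.equivFin ⟨z, hz⟩, ?_⟩
      simp only [hx, Algebra.smul_def, Equiv.symm_apply_apply]
  have hmem (i : Fin s.card) : algebraMap A B (x i) ∈ maximalIdeal B := by
    rw [← hxspan]
    exact Ideal.subset_span ⟨i, rfl⟩
  have hreg : IsWeaklyRegular B (List.ofFn fun i => algebraMap A B (x i)) := by
    refine isWeaklyRegular_ofFn_of_lechIndependent hmem fun N =>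
      ⟨p ^ N, Nat.lt_pow_self (Fact.out : p.Prime).one_lt, ?_⟩
    exact D.lechIndependent_pow Q hcard hxspan N
  have hmem' : ∀ z ∈ List.ofFn fun i => algebraMap A B (x i), z ∈ maximalIdeal B := by
    intro z hz
    obtain ⟨i, rfl⟩ := List.mem_ofFn.1 hz
    exact hmem i
  refine IsRegularLocalRing.of_spanFinrank_maximalIdeal_le _ ?_
  have := length_le_height_of_isWeaklyRegular (maximalIdeal B) hmem' hreg
  rw [List.length_ofFn] at this
  rw [← hcard, ← maximalIdeal_height_eq_ringKrullDim]
  exact_mod_cast this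

end Kunz

end

/-! ### F-finite rings as quotients of regular rings -/

section DigitCoord

open MvPolynomial

variable (p : ℕ) {R : Type*} [CommRing R] {n : ℕ}

/-- A tuple of digits below `p`, as an exponent. -/
noncomputable def digitExponent {p n : ℕ} (α : Fin n → Fin p) : Fin n →₀ ℕ :=
  Finsupp.equivFunOnFinite.symm fun i => (α i : ℕ)

theorem digitExponent_apply {p n : ℕ} (α : Fin n → Fin p) (i : Fin n) :
    digitExponent α i = α i := rfl

open Classical in
/-- The coefficient of `X ^ α` in the expansion of a polynomial in the basis `X ^ α`,
`0 ≤ α i < p`, of `R[X]` over `R[X ^ p]`: it sends `X ^ (p d + α)` to `X ^ d` and all other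
monomials to zero. -/
noncomputable def digitCoord (α : Fin n → Fin p) :
    MvPolynomial (Fin n) R →ₗ[R] MvPolynomial (Fin n) R :=
  (basisMonomials (Fin n) R).constr R fun d =>
    if ∀ i, d i % p = α i then monomial (d.mapRange (· / p) (Nat.zero_div p)) 1 else 0

open Classical in
theorem digitCoord_monomial (α : Fin n → Fin p) (d : Fin n →₀ ℕ) (r : R) :
    digitCoord p α (monomial d r) =
      if ∀ i, d i % p = α i then monomial (d.mapRange (· / p) (Nat.zero_div p)) r else 0 := by
  have h : monomial d r = r • basisMonomials (Fin n) R d := by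
    rw [coe_basisMonomials, smul_monomial, smul_eq_mul, mul_one]
  rw [h, map_smul, digitCoord, Module.Basis.constr_basis]
  split_ifs
  · rw [smul_monomial, smul_eq_mul, mul_one]
  · rw [smul_zero]

theorem digitCoord_expand_mul [Fact p.Prime] (α : Fin n → Fin p) (g h : MvPolynomial (Fin n) R) :
    digitCoord p α (expand p g * h) = g * digitCoord p α h := by
  have hp : 0 < p := (Fact.out : p.Prime).pos
  induction g using MvPolynomial.induction_on' with
  | add g₁ g₂ h₁ h₂ => rw [map_add, add_mul, map_add, h₁, h₂, add_mul]
  | monomial d r =>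
    induction h using MvPolynomial.induction_on' with
    | add h₁ h₂ e₁ e₂ => rw [mul_add, map_add, map_add, e₁, e₂, mul_add]
    | monomial d' r' =>
      rw [expand_monomial, monomial_mul, digitCoord_monomial, digitCoord_monomial]
      have h1 (i : Fin n) : (p • d + d') i % p = d' i % p := by simp
      simp only [h1]
      split_ifs
      · rw [monomial_mul]
        refine congrArg (monomial · _) (Finsupp.ext fun i => ?_)
        simp [Nat.mul_add_div hp]
      · rw [mul_zero]

theorem sum_expand_digitCoord_mul [Fact p.Prime] (f : MvPolynomial (Fin n) R) :
    ∑ α : Fin n → Fin p, expand p (digitCoord p α f) * monomial (digitExponent α) 1 = f := by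
  have hp : 0 < p := (Fact.out : p.Prime).pos
  induction f using MvPolynomial.induction_on' with
  | add f₁ f₂ h₁ h₂ =>
    simp only [map_add, add_mul, Finset.sum_add_distrib, h₁, h₂]
  | monomial d r =>
    rw [Finset.sum_eq_single fun i => ⟨d i % p, Nat.mod_lt _ hp⟩]
    · rw [digitCoord_monomial, if_pos fun i => rfl, expand_monomial, monomial_mul, mul_one]
      refine congrArg (monomial · _) (Finsupp.ext fun i => ?_)
      simp [digitExponent_apply, Nat.div_add_mod]
    · intro α _ hα
      rw [digitCoord_monomial, if_neg, map_zero, zero_mul]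
      intro h
      exact hα (funext fun i => Fin.ext (h i).symm)
    · exact fun h => absurd (Finset.mem_univ _) h

theorem map_digitCoord {R' : Type*} [CommRing R'] (φ : R →+* R') (α : Fin n → Fin p)
    (f : MvPolynomial (Fin n) R) : map φ (digitCoord p α f) = digitCoord p α (map φ f) := by
  induction f using MvPolynomial.induction_on' with
  | add f₁ f₂ h₁ h₂ => simp only [map_add, h₁, h₂]
  | monomial d r =>
    rw [digitCoord_monomial, map_monomial, digitCoord_monomial]
    split_ifs
    · rw [map_monomial]
    · rw [map_zero]

end DigitCoord

namespace RootTower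

open MvPolynomial

variable (p : ℕ) {R : Type u} [CommRing R] {n : ℕ} (x : Fin n → R)

/-- The ideal of `R[X]` generated by the `X i ^ (p ^ e) - x i`. -/
noncomputable def levelIdeal (e : ℕ) : Ideal (MvPolynomial (Fin n) R) :=
  Ideal.span (Set.range fun i => X i ^ p ^ e - C (x i))

/-- `R[X] / (X i ^ (p ^ e) - x i)`, the ring obtained from `R` by adjoining formal `p ^ e`-th roots
of the `x i`. -/
abbrev Level (e : ℕ) : Type u := MvPolynomial (Fin n) R ⧸ levelIdeal p x e

theorem expand_mem_levelIdeal {e : ℕ} {f : MvPolynomial (Fin n) R} (hf : f ∈ levelIdeal p x e) :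
    expand p f ∈ levelIdeal p x (e + 1) := by
  refine Ideal.span_le (I := (levelIdeal p x (e + 1)).comap (expand p).toRingHom) |>.2
    (Set.range_subset_iff.2 fun i => ?_) hf
  refine Ideal.subset_span ⟨i, ?_⟩
  simp [pow_succ', pow_mul]

theorem digitCoord_mem_levelIdeal [Fact p.Prime] {e : ℕ} {f : MvPolynomial (Fin n) R}
    (α : Fin n → Fin p) (hf : f ∈ levelIdeal p x (e + 1)) : digitCoord p α f ∈ levelIdeal p x e := by
  obtain ⟨c, rfl⟩ := Ideal.mem_span_range_iff_exists_fun.1 hf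
  rw [map_sum]
  refine Ideal.sum_mem _ fun i _ => ?_
  have h : c i * (X i ^ p ^ (e + 1) - C (x i)) = expand p (X i ^ p ^ e - C (x i)) * c i := by
    rw [mul_comm]
    simp [pow_succ', pow_mul]
  rw [h, digitCoord_expand_mul]
  exact Ideal.mul_mem_right _ _ (Ideal.subset_span ⟨i, rfl⟩)

/-- The map from the level `e` to the level `e + 1` given by `X i ↦ X i ^ p` over `R`. -/
noncomputable def incl (e : ℕ) : Level p x e →+* Level p x (e + 1) :=
  Ideal.quotientMap _ (expand p).toRingHom fun _ hf => expand_mem_levelIdeal p x hf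

theorem incl_mk (e : ℕ) (f : MvPolynomial (Fin n) R) :
    incl p x e (Ideal.Quotient.mk _ f) = Ideal.Quotient.mk _ (expand p f) := rfl

variable [Fact p.Prime]

/-- The coordinate at `X ^ α` of an element of the level `e + 1` over the level `e`. -/
noncomputable def levelCoord (e : ℕ) (α : Fin n → Fin p) : Level p x (e + 1) →+ Level p x e :=
  (Ideal.Quotient.mk (levelIdeal p x (e + 1))).toAddMonoidHom.liftOfSurjective
    Ideal.Quotient.mk_surjective
    ⟨(Ideal.Quotient.mk (levelIdeal p x e)).toAddMonoidHom.comp (digitCoord p α).toAddMonoidHom,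
      fun _ hf => Ideal.Quotient.eq_zero_iff_mem.2
        (digitCoord_mem_levelIdeal p x α (Ideal.Quotient.eq_zero_iff_mem.1 hf))⟩

theorem levelCoord_mk (e : ℕ) (α : Fin n → Fin p) (f : MvPolynomial (Fin n) R) :
    levelCoord p x e α (Ideal.Quotient.mk _ f) = Ideal.Quotient.mk _ (digitCoord p α f) :=
  AddMonoidHom.liftOfRightInverse_comp_apply _ _ _ _ f

theorem levelCoord_incl_mul (e : ℕ) (α : Fin n → Fin p) (g : Level p x e)
    (f : Level p x (e + 1)) :
    levelCoord p x e α (incl p x e g * f) = g * levelCoord p x e α f := by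
  obtain ⟨g, rfl⟩ := Ideal.Quotient.mk_surjective g
  obtain ⟨f, rfl⟩ := Ideal.Quotient.mk_surjective f
  rw [incl_mk, ← map_mul, levelCoord_mk, digitCoord_expand_mul, map_mul, levelCoord_mk]

theorem sum_incl_levelCoord_mul (e : ℕ) (f : Level p x (e + 1)) :
    ∑ α : Fin n → Fin p, incl p x e (levelCoord p x e α f) *
      Ideal.Quotient.mk _ (monomial (digitExponent α) 1) = f := by
  obtain ⟨f, rfl⟩ := Ideal.Quotient.mk_surjective f
  conv_rhs => rw [← sum_expand_digitCoord_mul p f, map_sum]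
  simp only [levelCoord_mk, incl_mk, map_mul]

variable [CharP R p]

theorem map_frobenius_mem_levelIdeal {e : ℕ} {f : MvPolynomial (Fin n) R}
    (hf : f ∈ levelIdeal p x (e + 1)) : map (frobenius R p) f ∈ levelIdeal p x e := by
  refine Ideal.span_le (I := (levelIdeal p x e).comap (map (frobenius R p))) |>.2
    (Set.range_subset_iff.2 fun i => ?_) hf
  have h : map (frobenius R p) (X i ^ p ^ (e + 1) - C (x i)) =
      (X i ^ p ^ e - C (x i)) ^ p := by
    rw [sub_pow_char]
    simp [frobenius_def, pow_succ, pow_mul]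
  rw [SetLike.mem_coe, Ideal.mem_comap, h]
  exact Ideal.pow_mem_of_mem (levelIdeal p x e) (Ideal.subset_span ⟨i, rfl⟩) _
    (Fact.out : p.Prime).pos

/-- The map from the level `e + 1` to the level `e` that fixes the roots `X i` and is Frobenius
on `R`. -/
noncomputable def trans (e : ℕ) : Level p x (e + 1) →+* Level p x e :=
  Ideal.quotientMap _ (map (frobenius R p)) fun _ hf => map_frobenius_mem_levelIdeal p x hf

theorem trans_mk (e : ℕ) (f : MvPolynomial (Fin n) R) :
    trans p x e (Ideal.Quotient.mk _ f) = Ideal.Quotient.mk _ (map (frobenius R p) f) := rfl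

theorem trans_levelCoord (e : ℕ) (α : Fin n → Fin p) (f : Level p x (e + 2)) :
    trans p x e (levelCoord p x (e + 1) α f) = levelCoord p x e α (trans p x (e + 1) f) := by
  obtain ⟨f, rfl⟩ := Ideal.Quotient.mk_surjective f
  rw [levelCoord_mk, trans_mk, trans_mk, levelCoord_mk, map_digitCoord]

theorem incl_trans (e : ℕ) (f : Level p x (e + 1)) : incl p x e (trans p x e f) = f ^ p := by
  obtain ⟨f, rfl⟩ := Ideal.Quotient.mk_surjective f
  rw [trans_mk, incl_mk, ← map_pow, ← map_expand, map_frobenius_expand]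

/-- The sequences of elements of the levels that are compatible with the maps `trans`. -/
noncomputable def limitSubring : Subring (∀ e, Level p x e) where
  carrier := {f | ∀ e, trans p x e (f (e + 1)) = f e}
  mul_mem' hf hg e := by simp only [Pi.mul_apply, map_mul, hf e, hg e]
  one_mem' e := by simp only [Pi.one_apply, map_one]
  add_mem' hf hg e := by simp only [Pi.add_apply, map_add, hf e, hg e]
  zero_mem' e := by simp only [Pi.zero_apply, map_zero]
  neg_mem' hf e := by simp only [Pi.neg_apply, map_neg, hf e]

/-- The limit of the tower of rings `R[X] / (X i ^ (p ^ e) - x i)` along the maps `trans`. -/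
def Limit : Type u := limitSubring p x

noncomputable instance : CommRing (Limit p x) := inferInstanceAs (CommRing (limitSubring p x))

/-- The element of the limit given by a compatible sequence. -/
def Limit.mk (f : ∀ e, Level p x e) (hf : ∀ e, trans p x e (f (e + 1)) = f e) : Limit p x :=
  (⟨f, hf⟩ : limitSubring p x)

/-- The projection from the limit to the level `e`. -/
noncomputable def proj (e : ℕ) : Limit p x →+* Level p x e :=
  (Pi.evalRingHom (fun e => Level p x e) e).comp (limitSubring p x).subtype

theorem proj_mk (e : ℕ) (f : ∀ e, Level p x e) (hf : ∀ e, trans p x e (f (e + 1)) = f e) :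
    proj p x e (Limit.mk p x f hf) = f e := rfl

theorem ext_proj {f g : Limit p x} (h : ∀ e, proj p x e f = proj p x e g) : f = g :=
  Subtype.ext (funext h)

theorem trans_proj (e : ℕ) (f : Limit p x) : trans p x e (proj p x (e + 1) f) = proj p x e f :=
  f.2 e

theorem ext_proj_succ {f g : Limit p x} (h : ∀ e, proj p x (e + 1) f = proj p x (e + 1) g) :
    f = g := by
  refine ext_proj p x fun e => ?_
  rw [← trans_proj, h, trans_proj]

theorem proj_succ_pow (e : ℕ) (f : Limit p x) :
    proj p x (e + 1) (f ^ p) = incl p x e (proj p x e f) := by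
  rw [map_pow, ← incl_trans, trans_proj]

/-- The limit of the tower of formal `p ^ e`-th roots has a dual basis for Frobenius, with the
monomials in the roots with exponents below `p` as generators: the `p`-th power of a sequence in
the limit is its shift, so that coordinates may be taken at each level. -/
noncomputable def frobeniusDualBasis : FrobeniusDualBasis p (Limit p x) (Fin n → Fin p) where
  T α := Limit.mk p x (fun _ => Ideal.Quotient.mk _ (monomial (digitExponent α) 1)) fun e => by
    rw [trans_mk, map_monomial, map_one]
  coord α :=
    { toFun f := Limit.mk p x (fun e => levelCoord p x e α (proj p x (e + 1) f)) fun e => by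
        rw [trans_levelCoord, trans_proj]
      map_zero' := ext_proj p x fun e => by rw [proj_mk, map_zero, map_zero, map_zero]
      map_add' f g := ext_proj p x fun e => by
        rw [proj_mk, map_add, map_add, map_add, proj_mk, proj_mk] }
  coord_pow_mul α g f := ext_proj p x fun e => by
    change levelCoord p x e α (proj p x (e + 1) (g ^ p * f)) = proj p x e (g * _)
    rw [map_mul, proj_succ_pow, levelCoord_incl_mul, map_mul]
    rfl
  sum_coord_pow_mul f := ext_proj_succ p x fun e => by
    rw [map_sum]
    conv_rhs => rw [← sum_incl_levelCoord_mul p x e (proj p x (e + 1) f)]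
    refine Finset.sum_congr rfl fun α _ => ?_
    rw [map_mul, proj_succ_pow]
    rfl

/-- The kernels of the projections from the limit to the levels. -/
noncomputable def kerIdeal (e : ℕ) : Ideal (Limit p x) := RingHom.ker (proj p x e)

theorem mem_kerIdeal {e : ℕ} {f : Limit p x} : f ∈ kerIdeal p x e ↔ proj p x e f = 0 := Iff.rfl

theorem kerIdeal_antitone : Antitone (kerIdeal p x) :=
  antitone_nat_of_succ_le fun e f hf => by
    rw [mem_kerIdeal] at hf ⊢
    rw [← trans_proj, hf, map_zero]

theorem pow_mem_kerIdeal {e : ℕ} {f : Limit p x} (hf : f ∈ kerIdeal p x e) :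
    f ^ p ∈ kerIdeal p x (e + 1) := by
  rw [mem_kerIdeal] at hf ⊢
  rw [proj_succ_pow, hf, map_zero]

theorem coord_mem_kerIdeal {e : ℕ} {f : Limit p x} (hf : f ∈ kerIdeal p x (e + 1))
    (α : Fin n → Fin p) : (frobeniusDualBasis p x).coord α f ∈ kerIdeal p x e := by
  rw [mem_kerIdeal] at hf ⊢
  change levelCoord p x e α (proj p x (e + 1) f) = 0
  rw [hf, map_zero]

theorem pow_pow_mem_kerIdeal {f : Limit p x} (hf : f ∈ kerIdeal p x 0) (e : ℕ) :
    f ^ p ^ e ∈ kerIdeal p x e := by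
  induction e with
  | zero => simpa using hf
  | succ e ih =>
    rw [pow_succ, pow_mul]
    exact pow_mem_kerIdeal p x ih

/-- An element of `kerIdeal (e + 1)` has coordinates in `kerIdeal e`, so it lies in the ideal
generated by the `p`-th powers of elements of `kerIdeal e`. -/
theorem kerIdeal_le_pow (e : ℕ) : kerIdeal p x e ≤ kerIdeal p x 0 ^ p ^ e := by
  induction e with
  | zero => simp
  | succ e ih =>
    intro f hf
    rw [← (frobeniusDualBasis p x).sum_coord_pow_mul f]
    refine Ideal.sum_mem _ fun α _ => Ideal.mul_mem_right _ _ ?_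
    rw [pow_succ, pow_mul]
    exact Ideal.pow_mem_pow (ih (coord_mem_kerIdeal p x hf α)) p

theorem exists_limit_of_kerIdeal (f : ℕ → Limit p x)
    (hf : ∀ e, f (e + 1) - f e ∈ kerIdeal p x e) : ∃ l, ∀ e, l - f e ∈ kerIdeal p x e := by
  refine ⟨Limit.mk p x (fun e => proj p x e (f e)) fun e => ?_, fun e => ?_⟩
  · rw [trans_proj, ← sub_eq_zero, ← map_sub]
    exact hf e
  · rw [mem_kerIdeal, map_sub, sub_eq_zero, proj_mk]

theorem eq_zero_of_forall_mem_kerIdeal {f : Limit p x} (hf : ∀ e, f ∈ kerIdeal p x e) : f = 0 :=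
  ext_proj p x fun e => by rw [hf e, map_zero]

variable (hx : ∀ S : Subring R, (∀ r, r ^ p ∈ S) → (∀ i, x i ∈ S) → S = ⊤)

include hx

/-- The image of `trans` contains the roots, hence the `x i`, and the `p`-th powers of elements
of `R`; such elements generate the level. -/
theorem trans_surjective (e : ℕ) : Function.Surjective (trans p x e) := by
  have hX (i : Fin n) : Ideal.Quotient.mk (levelIdeal p x e) (X i) ∈ (trans p x e).range :=
    ⟨Ideal.Quotient.mk _ (X i), by rw [trans_mk, map_X]⟩
  have hC : ((trans p x e).range.comap ((Ideal.Quotient.mk (levelIdeal p x e)).comp C)) = ⊤ := by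
    refine hx _ (fun r => ⟨Ideal.Quotient.mk _ (C r), ?_⟩) fun i => ?_
    · rw [trans_mk, map_C]
      rfl
    · have : Ideal.Quotient.mk (levelIdeal p x e) (C (x i)) =
          Ideal.Quotient.mk _ (X i) ^ p ^ e := by
        rw [← map_pow, eq_comm, Ideal.Quotient.eq]
        exact Ideal.subset_span ⟨i, rfl⟩
      rw [Subring.mem_comap, RingHom.comp_apply, this]
      exact pow_mem (hX i) _
  intro f
  obtain ⟨f, rfl⟩ := Ideal.Quotient.mk_surjective f
  change _ ∈ (trans p x e).range
  induction f using MvPolynomial.induction_on with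
  | C r => exact Subring.mem_comap.1 (hC ▸ Subring.mem_top r :
      r ∈ (trans p x e).range.comap ((Ideal.Quotient.mk (levelIdeal p x e)).comp C))
  | add f g hf hg => rw [map_add]; exact add_mem hf hg
  | mul_X f i hf => rw [map_mul]; exact mul_mem hf (hX i)

theorem proj_surjective (e : ℕ) : Function.Surjective (proj p x e) := by
  have hlift (e : ℕ) (P : MvPolynomial (Fin n) R) : ∃ Q : MvPolynomial (Fin n) R,
      Ideal.Quotient.mk (levelIdeal p x e) (map (frobenius R p) Q) = Ideal.Quotient.mk _ P := by
    obtain ⟨Q, hQ⟩ := trans_surjective p x hx e (Ideal.Quotient.mk _ P)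
    obtain ⟨Q, rfl⟩ := Ideal.Quotient.mk_surjective Q
    exact ⟨Q, hQ⟩
  choose l hl using hlift
  intro f
  obtain ⟨P, rfl⟩ := Ideal.Quotient.mk_surjective f
  -- polynomials representing the components of a compatible sequence above the level `e`
  let g : ℕ → MvPolynomial (Fin n) R := fun k => Nat.rec P (fun k Q => l (e + k) Q) k
  refine ⟨Limit.mk p x
    (fun k => Ideal.Quotient.mk _ ((map (frobenius R p))^[e - k] (g (k - e)))) fun k => ?_, ?_⟩
  · rw [trans_mk]
    rcases le_or_gt e k with hk | hk
    · have h1 : e - (k + 1) = 0 := by omega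
      have h2 : e - k = 0 := by omega
      have h3 : k + 1 - e = k - e + 1 := by omega
      have h4 : e + (k - e) = k := by omega
      rw [h1, h2, h3]
      change Ideal.Quotient.mk _ (map (frobenius R p) (l (e + (k - e)) (g (k - e)))) = _
      rw [h4, hl]
      rfl
    · have h1 : k + 1 - e = 0 := by omega
      have h2 : k - e = 0 := by omega
      have h3 : e - k = e - (k + 1) + 1 := by omega
      rw [h1, h2, h3, Function.iterate_succ_apply']
  · rw [proj_mk, Nat.sub_self]
    rfl

/-- The kernel of the projection to the level `0` is finitely generated: the level `1` being
Noetherian, finitely many elements generate it modulo the kernel at the level `1`, and the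
Frobenius powers of this relation let one approximate its elements successively. -/
theorem exists_kerIdeal_zero_eq_span [CharP (Limit p x) p] [IsNoetherianRing R] :
    ∃ (m : ℕ) (g : Fin m → Limit p x), kerIdeal p x 0 = Ideal.span (Set.range g) := by
  have hmap : ((kerIdeal p x 0).map (proj p x 1)).FG := IsNoetherian.noetherian _
  obtain ⟨m, z, hz⟩ := Submodule.fg_iff_exists_fin_generating_family.1 hmap
  have hzmem (i : Fin m) : ∃ g ∈ kerIdeal p x 0, proj p x 1 g = z i := by
    refine (Ideal.mem_map_iff_of_surjective _ (proj_surjective p x hx 1)).1 ?_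
    rw [← hz]
    exact Submodule.subset_span ⟨i, rfl⟩
  choose g hg hgz using hzmem
  -- approximation of elements of `kerIdeal e` by combinations of `p ^ e`-th powers
  have happrox (e : ℕ) : ∀ j ∈ kerIdeal p x e,
      ∃ c : Fin m → Limit p x, j - ∑ i, c i * g i ^ p ^ e ∈ kerIdeal p x (e + 1) := by
    induction e with
    | zero =>
      intro j hj
      have h1 : proj p x 1 j ∈ Ideal.span (Set.range z) := by
        rw [Ideal.span, hz]
        exact Ideal.mem_map_of_mem _ hj
      obtain ⟨c, hc⟩ := Ideal.mem_span_range_iff_exists_fun.1 h1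
      choose c' hc' using fun i => proj_surjective p x hx 1 (c i)
      refine ⟨c', ?_⟩
      rw [mem_kerIdeal, map_sub, sub_eq_zero, map_sum, ← hc]
      exact Finset.sum_congr rfl fun i _ => by
        rw [map_mul, hc', pow_zero, pow_one, hgz]
    | succ e ih =>
      intro j hj
      choose c hc using fun α => ih _ (coord_mem_kerIdeal p x hj α)
      refine ⟨fun i => ∑ α, c α i ^ p * (frobeniusDualBasis p x).T α, ?_⟩
      have h1 : j - ∑ i, (∑ α, c α i ^ p * (frobeniusDualBasis p x).T α) * g i ^ p ^ (e + 1) =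
          ∑ α, ((frobeniusDualBasis p x).coord α j - ∑ i, c α i * g i ^ p ^ e) ^ p *
            (frobeniusDualBasis p x).T α := by
        conv_lhs => rw [← (frobeniusDualBasis p x).sum_coord_pow_mul j]
        simp only [sub_pow_char, sum_pow_char, sub_mul, Finset.sum_sub_distrib, Finset.sum_mul,
          mul_pow, ← pow_mul, ← pow_succ]
        rw [Finset.sum_comm]
        congr 1
        exact Finset.sum_congr rfl fun α _ => Finset.sum_congr rfl fun i _ => by ring
      rw [h1]
      exact Ideal.sum_mem _ fun α _ =>
        Ideal.mul_mem_right _ _ (pow_mem_kerIdeal p x (hc α))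
  let K : ℕ → Ideal (Limit p x) := fun k => Nat.casesOn k ⊤ (kerIdeal p x)
  have hKs (e : ℕ) : K (e + 1) = kerIdeal p x e := rfl
  have hK : Antitone K := antitone_nat_of_succ_le fun e => by
    cases e with
    | zero => exact le_top
    | succ e => exact kerIdeal_antitone p x e.le_succ
  refine ⟨m, g, le_antisymm (fun j hj => ?_) (Ideal.span_le.2 (Set.range_subset_iff.2 hg))⟩
  refine mem_span_range_of_approximation hK (fun f hf => ?_)
    (fun f hf => eq_zero_of_forall_mem_kerIdeal p x fun e => hf (e + 1)) hg 1 ?_ hj trivial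
  · obtain ⟨l, hl⟩ := exists_limit_of_kerIdeal p x (fun e => f (e + 1)) fun e => hf (e + 1)
    refine ⟨l, fun e => ?_⟩
    cases e with
    | zero => trivial
    | succ e => exact hl e
  · intro k j hj hjk
    cases k with
    | zero => exact ⟨0, fun i => zero_mem _, by simpa [hKs] using hj⟩
    | succ e =>
      obtain ⟨c, hc⟩ := happrox e j hjk
      have hpe : 0 < p ^ e := pow_pos (Fact.out : p.Prime).pos e
      refine ⟨fun i => c i * g i ^ (p ^ e - 1), fun i => Ideal.mul_mem_left _ _ ?_, ?_⟩
      · cases e with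
        | zero => trivial
        | succ e =>
          have h1 : p ^ e ≤ p ^ (e + 1) - 1 :=
            Nat.le_sub_one_of_lt
              (Nat.pow_lt_pow_right (Fact.out : p.Prime).one_lt e.lt_succ_self)
          exact Ideal.mem_of_dvd _ (pow_dvd_pow _ h1) (pow_pow_mem_kerIdeal p x (hg i) e)
      · simpa only [mul_assoc, ← pow_succ, Nat.sub_add_cancel hpe] using hc

/-- The limit is complete for the powers of the finitely generated ideal `kerIdeal 0`, with the
Noetherian quotient `R[X] / (X i - x i)`. -/
theorem isNoetherianRing_limit [CharP (Limit p x) p] [IsNoetherianRing R] :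
    IsNoetherianRing (Limit p x) := by
  obtain ⟨m, g, hg⟩ := exists_kerIdeal_zero_eq_span p x hx
  have hquot : IsNoetherianRing (Limit p x ⧸ kerIdeal p x 0) :=
    isNoetherianRing_of_ringEquiv _
      (RingHom.quotientKerEquivOfSurjective (proj_surjective p x hx 0)).symm
  -- the powers of `kerIdeal 0` and the ideals `kerIdeal e` define the same topology
  have hle (e : ℕ) : kerIdeal p x e ≤ kerIdeal p x 0 ^ e :=
    (kerIdeal_le_pow p x e).trans
      (Ideal.pow_le_pow_right (Nat.lt_pow_self (Fact.out : p.Prime).one_lt).le)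
  have hpow (e : ℕ) : ∃ N, kerIdeal p x 0 ^ N ≤ kerIdeal p x e := by
    refine Ideal.exists_pow_le_of_le_radical_of_fg
      (fun f hf => ⟨_, pow_pow_mem_kerIdeal p x hf e⟩) ?_
    rw [hg]
    exact ⟨(Set.finite_range g).toFinset, by simp⟩
  choose N hN using hpow
  let M : ℕ → ℕ := fun e => e + ∑ i ∈ Finset.range (e + 1), N i
  have hMe (e : ℕ) : e ≤ M e := Nat.le_add_right _ _
  have hMN (e : ℕ) : N e ≤ M e :=
    (Finset.single_le_sum (fun i _ => Nat.zero_le (N i)) (Finset.self_mem_range_succ e)).trans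
      (Nat.le_add_left _ _)
  have hMmono : Monotone M := monotone_nat_of_le_succ fun e => by
    simp only [M]
    rw [Finset.sum_range_succ _ (e + 1)]
    omega
  have hdiff (f : ℕ → Limit p x) (hf : ∀ e, f (e + 1) - f e ∈ kerIdeal p x 0 ^ e) {a b : ℕ}
      (hab : a ≤ b) : f b - f a ∈ kerIdeal p x 0 ^ a := by
    induction b, hab using Nat.le_induction with
    | base => simp
    | succ b hab ih =>
      have := add_mem (Ideal.pow_le_pow_right hab (hf b)) ih
      rwa [sub_add_sub_cancel] at this
  refine isNoetherianRing_of_complete g (kerIdeal p x 0) hg (fun f hf => ?_) fun f hf =>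
    eq_zero_of_forall_mem_kerIdeal p x fun e => hN e (hf _)
  obtain ⟨l, hl⟩ := exists_limit_of_kerIdeal p x (fun e => f (M e)) fun e =>
    hN e (Ideal.pow_le_pow_right (hMN e) (hdiff f hf (hMmono e.le_succ)))
  refine ⟨l, fun e => ?_⟩
  have := add_mem (hle e (hl e)) (hdiff f hf (hMe e))
  rwa [sub_add_sub_cancel] at this

/-- Evaluation `X i ↦ x i` at the level `0` makes the limit surject onto `R`. -/
theorem exists_surjective_limit : ∃ φ : Limit p x →+* R, Function.Surjective φ := by
  refine ⟨(Ideal.Quotient.lift (levelIdeal p x 0) (eval x) fun f hf => ?_).comp (proj p x 0), ?_⟩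
  · refine Ideal.span_le (I := RingHom.ker (eval x)) |>.2 (Set.range_subset_iff.2 fun i => ?_) hf
    simp [RingHom.mem_ker]
  · rw [RingHom.coe_comp]
    refine Function.Surjective.comp (fun r => ⟨Ideal.Quotient.mk _ (C r), ?_⟩)
      (proj_surjective p x hx 0)
    exact eval_C r

end RootTower

/-- Gabber: an F-finite Noetherian ring is a quotient of a regular ring. -/
theorem IsFFinite.exists_isRegularRing_surjective {p : ℕ} [Fact p.Prime] {R : Type u} [CommRing R]
    [CharP R p] [IsNoetherianRing R] [Nontrivial R] (hR : IsFFinite p R) :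
    ∃ (A : Type u) (_ : CommRing A) (_ : IsRegularRing A) (φ : A →+* R),
      Function.Surjective φ := by
  obtain ⟨n, x, hx⟩ := @Module.Finite.exists_fin R R _ _ (frobenius R p).toAlgebra.toModule hR
  have hgen (S : Subring R) (hp : ∀ r, r ^ p ∈ S) (hxS : ∀ i, x i ∈ S) : S = ⊤ := by
    refine top_le_iff.1 fun r _ => ?_
    have hr : r ∈ @Submodule.span R R _ _ (frobenius R p).toAlgebra.toModule (Set.range x) := by
      rw [hx]; trivial
    refine @Submodule.span_induction R R _ _ (frobenius R p).toAlgebra.toModule _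
      (fun r _ => r ∈ S) ?_ (zero_mem S) (fun _ _ _ _ => add_mem) ?_ r hr
    · rintro _ ⟨i, rfl⟩
      exact hxS i
    · intro a z _ hz
      exact mul_mem (hp a) hz
  obtain ⟨φ, hφ⟩ := RootTower.exists_surjective_limit p x hgen
  have : Nontrivial (RootTower.Limit p x) := φ.domain_nontrivial
  have : CharP (RootTower.Limit p x) p := by
    refine (CharP.charP_iff_prime_eq_zero Fact.out).2 ?_
    refine RootTower.ext_proj p x fun e => ?_
    rw [map_natCast, map_zero, ← map_natCast (Ideal.Quotient.mk (RootTower.levelIdeal p x e)),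
      ← map_natCast (MvPolynomial.C : R →+* MvPolynomial (Fin n) R), CharP.cast_eq_zero, map_zero,
      map_zero]
  have := RootTower.isNoetherianRing_limit p x hgen
  exact ⟨RootTower.Limit p x, inferInstance, (RootTower.frobeniusDualBasis p x).isRegularRing,
    φ, hφ⟩

/-! ### Tight closure and parameter test modules -/

/-- The tight closure of modules over an F-finite domain is the intersection of the module closures
given by the parameter test modules of its module-finite domain extensions.  Moreover, over each
such extension `S` all tight interiors are durable test modules, a canonical module `ω_S` exists, and
`τ(ω_S) = (ω_S)_*`, so that `τ(ω_S)` is a durable test module. -/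
theorem theorem7p6 (p : ℕ) [Fact p.Prime] (R : Type u) [CommRing R] [IsDomain R]
    [IsNoetherianRing R] [CharP R p] (hR : IsFFinite p R) :
    (∀ (M : Type v) [AddCommGroup M] [Module R M] (L : Submodule R M),
      tightClosure p L = parameterTestClosure p L) ∧
    ∀ (S : Type u) [CommRing S] [IsDomain S] [CharP S p] [Algebra R S] [Module.Finite R S]
      [FaithfulSMul R S],
      (∀ (U : Type w) [AddCommGroup U] [Module S U],
        IsDurableTestModule.{u, v, w} p S (tightInterior p S U)) ∧
      (∃ (ω : Type u) (_ : AddCommGroup ω) (_ : Module S ω), IsCanonicalModule S ω) ∧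
      ∀ (ω : Type u) [AddCommGroup ω] [Module S ω], IsCanonicalModule S ω →
        parameterTestSubmodule p S ω = tightInterior p S ω ∧
        IsDurableTestModule.{u, v, u} p S (parameterTestSubmodule p S ω) := by
  have canonical (S : Type u) [CommRing S] [IsDomain S] [CharP S p] [IsNoetherianRing S]
      (hS : IsFFinite p S) :
      ∃ (ω : Type u) (_ : AddCommGroup ω) (_ : Module S ω), IsCanonicalModule S ω := by
    obtain ⟨A, _, _, φ, hφ⟩ := hS.exists_isRegularRing_surjective
    exact exists_isCanonicalModule_of_surjective φ hφ
  refine ⟨fun M _ _ L => le_antisymm (le_sInf ?_) ?_, fun S _ _ _ _ _ _ => ?_⟩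
  · rintro _ ⟨S, _, _, _, _, _, _, ω, _, _, _, _, hω, rfl⟩
    have : IsNoetherianRing S := IsNoetherianRing.of_finite R S
    have := hω.finite
    have := hω.isTorsionFree
    have := hω.nontrivial
    exact tightClosure_le_moduleClosure (hR.of_finite S) L
  · obtain ⟨ω, _, _, hω⟩ := canonical R hR
    have := hω.finite
    have := hω.isTorsionFree
    have := hω.nontrivial
    exact parameterTestClosure_le_tightClosure hR hω L
  · have : IsNoetherianRing S := IsNoetherianRing.of_finite R S
    have hS := hR.of_finite S
    refine ⟨fun U _ _ => isDurableTestModule_tightInterior hS U, canonical S hS,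
      fun ω _ _ hω => ?_⟩
    have := hω.finite
    have := hω.isTorsionFree
    have := hω.nontrivial
    have h := parameterTestSubmodule_eq_tightInterior (p := p) (ω := ω) hS
    exact ⟨h, h ▸ isDurableTestModule_tightInterior hS ω⟩
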